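/- Let $G$ be a finite group, $S\subseteq G$ symmetric ($S=S^{-1}$), and let $\mathrm{Cay}(G,S)$ have adjacency operator $\mathcal A f(g)=\sum_{s\in S}f(gs)$ on $\ell^2(G)$ (counting measure). Let $\hat G$ be a set of representatives $(\pi,V)$ of the equivalence classes of irreducible unitary representations of $G$, with $\langle\cdot,\cdot\rangle$ linear in its first argument, and put $\pi(A)=\sum_{s\in S}\pi(s)$. A representation in $\hat G$ is either not equivalent to its dual $\check\pi$, or self-dual; in the latter case there is a conjugate-linear map $J:V\to V$ commuting with $\pi$ such that either $J^2=\mathrm{Id}$ ($\pi$ is real; put $V_J=\{v:Jv=v\}$) or $J^2=-\mathrm{Id}$ ($\pi$ is quaternionic). Fix the following choices. (1) One member $\pi$ of each pair $\{\pi,\check\pi\}\subseteq\hat G$ of non-self-dual representations, with an orthonormal basis $\{v_k\}_{k\le\dim V}$ of $V$ of eigenvectors of $\pi(A)$ and an orthonormal basis $\{e_j\}_{j\le \dim V}$ of $V$. (2) For each quaternionic $\pi$, a map $J$ as above, an orthonormal basis of $V$ of eigenvectors of $\pi(A)$ of the form $\{v_k,Jv_k\}_{k\le\frac12\dim V}$,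 and an orthonormal basis $\{e_j\}_{j\le \dim V}$ of $V$. (3) For each real $\pi$, a map $J$ as above, an orthonormal basis $\{v_k\}_{k\le\dim V}$ of the real inner product space $V_J$ of eigenvectors of $\pi(A)$, and an orthonormal basis $\{e_j\}_{j\le\dim V}$ of $V_J$. Choose independent Haar-distributed random operators: $u\in U(V)$ for each $\pi$ in (1) and (2), and $o\in O(V_J)$ for each $\pi$ in (3). Set $w_j=ue_j$ in (1), (2) and $w_j=oe_j$ in (3). Let $\mathcal B$ consist of the functions $$g\mapsto\frac{\sqrt{2\dim V}}{\sqrt{|G|}}\,\mathrm{Re}\langle\pi(g)v_k,w_j\rangle,\qquad g\mapsto\frac{\sqrt{2\dim V}}{\sqrt{|G|}}\,\mathrm{Im}\langle\pi(g)v_k,w_j\rangle$$ for each $\pi$ in (1) (with $k,j\le\dim V$) and in (2) (with $k\le\frac12\dim V$, $j\le\dim V$), and of the functions $$g\mapsto\frac{\sqrt{\dim V}}{\sqrt{|G|}}\langle\pi(g)v_k,w_j\rangle\qquad(k,j\le\dim V)$$ for each $\pi$ in (3). Then $\mathcal B$ is always an orthonormal basis of $\ell^2(G)$ consisting of real-valued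 eigenfunctions of $\mathcal A$. Moreover, for any $M\in\mathbb N$, any $f_1,\dots,f_M:G\to\mathbb R$ and any $t>0$, with probability at least $$1-2M\sum_{(\pi,V)\in\hat G-\mathrm{triv}}(\dim V)^2\left(6e^{-\frac{t\sqrt{\dim V}}{64}}+2e^{-\frac{\dim V}{12}}\right)$$ every $\varphi\in\mathcal B$ and every $i=1,\dots,M$ satisfy $$\left|\mu_\varphi[f_i]-\frac{1}{|G|}\sum_{g\in G}f_i(g)\right|\le t\,\frac{\|f_i\|_{\ell^2}}{\sqrt{|G|}},\qquad\text{where } \mu_\varphi[f]=\sum_{g\in G}|\varphi(g)|^2f(g).$$ -/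

import Mathlib

open MeasureTheory

universe u v w

noncomputable section

/-! ### Haar probability measure on the unitary group `U(E)` or orthogonal group `O(E)` -/

/-- For a finite-dimensional Hilbert space `E` over `𝕜 = ℝ` or `ℂ`, the group of operators `T` with
`T* T = T T* = 1`: the unitary group `U(E)` if `𝕜 = ℂ`, the orthogonal group `O(E)` if `𝕜 = ℝ`. It
carries the topology and the Borel structure of the operator norm. -/
abbrev IsometryGroup (𝕜 : Type*) [RCLike 𝕜] (E : Type*) [NormedAddCommGroup E]
    [InnerProductSpace 𝕜 E] [CompleteSpace E] : Type _ :=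
  unitary (E →L[𝕜] E)

instance IsometryGroup.instCompactSpace (𝕜 : Type*) [RCLike 𝕜] (E : Type*) [NormedAddCommGroup E]
    [InnerProductSpace 𝕜 E] [CompleteSpace E] [FiniteDimensional 𝕜 E] :
    CompactSpace (IsometryGroup 𝕜 E) := by
  have : ProperSpace (E →L[𝕜] E) := FiniteDimensional.proper 𝕜 _
  suffices h : IsCompact ((unitary (E →L[𝕜] E) : Submonoid (E →L[𝕜] E)) : Set (E →L[𝕜] E)) from
    isCompact_iff_compactSpace.mp h
  refine Metric.isCompact_of_isClosed_isBounded ?_ ?_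
  · have h : ((unitary (E →L[𝕜] E) : Submonoid (E →L[𝕜] E)) : Set (E →L[𝕜] E)) =
        {T | star T * T = 1} ∩ {T | T * star T = 1} := by
      ext T; simp [Unitary.mem_iff]
    rw [h]
    exact (isClosed_eq (by fun_prop) continuous_const).inter
      (isClosed_eq (by fun_prop) continuous_const)
  · refine (Metric.isBounded_closedBall (x := (0 : E →L[𝕜] E)) (r := 1)).subset ?_
    intro T hT
    rw [mem_closedBall_zero_iff]
    refine T.opNorm_le_bound zero_le_one fun x => ?_
    rw [one_mul, ContinuousLinearMap.norm_map_of_mem_unitary hT]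

/-- The Haar probability measure on `U(E)` or `O(E)`. -/
def haarProb (𝕜 : Type*) [RCLike 𝕜] (E : Type*) [NormedAddCommGroup E]
    [InnerProductSpace 𝕜 E] [CompleteSpace E] [FiniteDimensional 𝕜 E] :
    Measure (IsometryGroup 𝕜 E) :=
  Measure.haarMeasure ⊤

/-! ### Unitary representations -/

/-- A finite-dimensional unitary representation `(π, V)` of `G`. -/
structure UnitaryRep (G : Type v) [Group G] where
  V : Type w
  [instNormedAddCommGroup : NormedAddCommGroup V]
  [instInnerProductSpace : InnerProductSpace ℂ V]
  [instFiniteDimensional : FiniteDimensional ℂ V]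
  π : G →* (V ≃ₗᵢ[ℂ] V)

namespace UnitaryRep

attribute [instance] instNormedAddCommGroup instInnerProductSpace instFiniteDimensional

variable {G : Type v} [Group G]

instance instCompleteSpace (R : UnitaryRep.{v, w} G) : CompleteSpace R.V :=
  FiniteDimensional.complete ℂ R.V

/-- The real inner product `Re ⟪·, ·⟫` on `V`. -/
instance instInnerProductSpaceReal (R : UnitaryRep.{v, w} G) : InnerProductSpace ℝ R.V :=
  InnerProductSpace.complexToReal

/-- `dim V`, the complex dimension. -/
abbrev dim (R : UnitaryRep.{v, w} G) : ℕ := Module.finrank ℂ R.V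

/-- The underlying linear representation. -/
def toRepresentation (R : UnitaryRep.{v, w} G) : Representation ℂ G R.V where
  toFun g := (R.π g).toLinearEquiv.toLinearMap
  map_one' := by ext; simp
  map_mul' g h := by ext; simp

/-- Irreducibility: `V ≠ 0` and there is no invariant subspace other than `0` and `V`. -/
def IsIrreducible (R : UnitaryRep.{v, w} G) : Prop :=
  Representation.IsIrreducible R.toRepresentation

/-- Equivalence: a unitary isomorphism intertwines the two representations. -/
def Equivalent (R : UnitaryRep.{v, u} G) (R' : UnitaryRep.{v, w} G) : Prop :=
  ∃ T : R.V ≃ₗᵢ[ℂ] R'.V, ∀ (g : G) (x : R.V), T (R.π g x) = R'.π g (T x)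

/-- The trivial representation on `ℂ`. -/
def triv (G : Type v) [Group G] : UnitaryRep.{v, 0} G where
  V := ℂ
  π := 1

/-- `R'` is equivalent to the dual (contragredient) representation of `R`, that is, to the dual
space of `V` with the (Hilbert) dual norm and the action `(g α)(x) = α (π(g⁻¹) x)`. -/
def IsDualOf (R' R : UnitaryRep.{v, w} G) : Prop :=
  ∃ T : R'.V ≃ₗᵢ[ℂ] StrongDual ℂ R.V,
    ∀ (g : G) (y : R'.V) (x : R.V), T (R'.π g y) x = T y (R.π g⁻¹ x)

def IsSelfDual (R : UnitaryRep.{v, w} G) : Prop := R.IsDualOf R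

/-- `J` is a conjugate-linear intertwining map `V → V` with `J² = ε`. -/
def IsStructureMap (R : UnitaryRep.{v, w} G) (ε : ℂ) (J : R.V →ₛₗ[starRingEnd ℂ] R.V) : Prop :=
  (∀ (g : G) (x : R.V), J (R.π g x) = R.π g (J x)) ∧ ∀ x : R.V, J (J x) = ε • x

/-- Self-dual of real type. -/
def IsRealType (R : UnitaryRep.{v, w} G) : Prop :=
  R.IsSelfDual ∧ ∃ J : R.V →ₛₗ[starRingEnd ℂ] R.V, R.IsStructureMap 1 J

/-- Self-dual of quaternionic type. -/
def IsQuaternionicType (R : UnitaryRep.{v, w} G) : Prop :=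
  R.IsSelfDual ∧ ∃ J : R.V →ₛₗ[starRingEnd ℂ] R.V, R.IsStructureMap (-1) J

/-- The real vector space `V_J = {x : J x = x}`, with the inner product inherited from `V`. -/
def realForm (R : UnitaryRep.{v, w} G) (J : R.V →ₛₗ[starRingEnd ℂ] R.V) : Submodule ℝ R.V where
  carrier := {x | J x = x}
  add_mem' {x y} hx hy := by
    simp only [Set.mem_ofPred_eq] at hx hy ⊢
    rw [map_add, hx, hy]
  zero_mem' := by simp
  smul_mem' c x hx := by
    simp only [Set.mem_ofPred_eq] at hx ⊢
    rw [← Complex.coe_smul, LinearMap.map_smulₛₗ, hx, Complex.conj_ofReal]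

instance instCompleteSpaceRealForm (R : UnitaryRep.{v, w} G) (J : R.V →ₛₗ[starRingEnd ℂ] R.V) :
    CompleteSpace (R.realForm J) :=
  FiniteDimensional.complete ℝ (R.realForm J)

/-- `x` is an eigenvector (up to `x ≠ 0`) of `π(A) = ∑_{s ∈ S} π(s)`. -/
def IsEigenvector (R : UnitaryRep.{v, w} G) (S : Finset G) (x : R.V) : Prop :=
  ∃ c : ℂ, ∑ s ∈ S, R.π s x = c • x

/-- The matrix coefficient `g ↦ ⟨π(g) x, y⟩`, linear in `x` and conjugate-linear in `y`
(Mathlib's inner product is conjugate-linear in its first argument). -/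
def coeff (R : UnitaryRep.{v, w} G) (x y : R.V) (g : G) : ℂ := inner ℂ y (R.π g x)

end UnitaryRep

/-- The family `irr` is the unitary dual of `G`: it contains exactly one representative of each
equivalence class of irreducible unitary representations. -/
structure IsUnitaryDual {G : Type u} [Group G] {ι : Type w} (irr : ι → UnitaryRep.{u, u} G) :
    Prop where
  irreducible : ∀ i, (irr i).IsIrreducible
  injective : ∀ i j, (irr i).Equivalent (irr j) → i = j
  complete : ∀ R : UnitaryRep.{u, u} G, R.IsIrreducible → ∃ i, R.Equivalent (irr i)

/-! ### Cayley graphs, eigenbases, quantum measures -/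

/-- The adjacency operator of `Cay(G, S)` on `ℓ²(G)` (counting measure): right convolution
`f ↦ (g ↦ ∑_{s ∈ S} f (g s))`. -/
def cayleyAdjacency {G : Type u} [Group G] [Fintype G] (S : Finset G) (φ : EuclideanSpace ℂ G) :
    EuclideanSpace ℂ G :=
  WithLp.toLp 2 fun g => ∑ s ∈ S, φ (g * s)

/-- The family `b` is an orthonormal basis of `ℓ²(G)` that consists of real-valued eigenfunctions
of `Cay(G, S)`. -/
def IsRealOrthonormalEigenbasis {G : Type u} [Group G] [Fintype G] (S : Finset G) {κ : Type*}
    (b : κ → EuclideanSpace ℂ G) : Prop :=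
  Orthonormal ℂ b ∧ Submodule.span ℂ (Set.range b) = ⊤ ∧
    ∀ k, (∀ g, (b k g).im = 0) ∧ ∃ c : ℝ, cayleyAdjacency S (b k) = (c : ℂ) • b k

/-- `μ_φ[f]`, where `μ_φ = ∑_g |φ(g)|² δ_g`. -/
def quantumMean {G : Type u} [Fintype G] (φ : EuclideanSpace ℂ G) (f : EuclideanSpace ℝ G) : ℝ :=
  ∑ g, ‖φ g‖ ^ 2 * f g

/-! ### The random basis -/

/-- The non-random choices made in the construction of the random eigenbasis. -/
structure BasisChoices {G : Type u} [Group G] {ι : Type w} (irr : ι → UnitaryRep.{u, u} G)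
    (S : Finset G) where
  /-- One member of each pair `{π, π̌}` of mutually dual non-self-dual representations. -/
  C : Set ι
  not_selfDual : ∀ i ∈ C, ¬ (irr i).IsSelfDual
  pair : ∀ i j, ¬ (irr i).IsSelfDual → (irr j).IsDualOf (irr i) → Xor (i ∈ C) (j ∈ C)
  /-- Non-self-dual case: an orthonormal eigenbasis of `π(A)`. -/
  vC : ∀ i : C, OrthonormalBasis (Fin (irr i).dim) ℂ (irr i).V
  vC_eigen : ∀ (i : C) k, (irr i).IsEigenvector S (vC i k)
  /-- Non-self-dual case: the fixed orthonormal basis, to be rotated. -/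
  eC : ∀ i : C, OrthonormalBasis (Fin (irr i).dim) ℂ (irr i).V
  /-- Quaternionic case: the conjugate-linear intertwiner with `J² = -1`. -/
  JQ : ∀ i : {i // (irr i).IsQuaternionicType}, (irr i).V →ₛₗ[starRingEnd ℂ] (irr i).V
  JQ_spec : ∀ i : {i // (irr i).IsQuaternionicType}, (irr i).IsStructureMap (-1) (JQ i)
  /-- Quaternionic case: an orthonormal eigenbasis of `π(A)` of the form `{v_k, J v_k}`,
  `1 ≤ k ≤ dim V / 2`, where `v_k` has index `inl k` and `J v_k` has index `inr k`. -/
  vQ : ∀ i : {i // (irr i).IsQuaternionicType},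
    OrthonormalBasis (Fin ((irr i).dim / 2) ⊕ Fin ((irr i).dim / 2)) ℂ (irr i).V
  vQ_J : ∀ i k, vQ i (Sum.inr k) = JQ i (vQ i (Sum.inl k))
  vQ_eigen : ∀ (i : {i // (irr i).IsQuaternionicType}) k,
    (irr i).IsEigenvector S (vQ i k)
  /-- Quaternionic case: the fixed orthonormal basis, to be rotated. -/
  eQ : ∀ i : {i // (irr i).IsQuaternionicType},
    OrthonormalBasis (Fin (irr i).dim) ℂ (irr i).V
  /-- Real case: the conjugate-linear intertwiner with `J² = 1`. -/
  JR : ∀ i : {i // (irr i).IsRealType}, (irr i).V →ₛₗ[starRingEnd ℂ] (irr i).V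
  JR_spec : ∀ i : {i // (irr i).IsRealType}, (irr i).IsStructureMap 1 (JR i)
  /-- Real case: an orthonormal basis of `V_J` of eigenvectors of `π(A)`. -/
  vR : ∀ i : {i // (irr i).IsRealType},
    OrthonormalBasis (Fin (irr i).dim) ℝ ((irr i).realForm (JR i))
  vR_eigen : ∀ (i : {i // (irr i).IsRealType}) k,
    (irr i).IsEigenvector S (vR i k : (irr i).V)
  /-- Real case: the fixed orthonormal basis of `V_J`, to be rotated. -/
  eR : ∀ i : {i // (irr i).IsRealType},
    OrthonormalBasis (Fin (irr i).dim) ℝ ((irr i).realForm (JR i))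

namespace BasisChoices

variable {G : Type u} [Group G] {ι : Type w} {irr : ι → UnitaryRep.{u, u} G} {S : Finset G}

/-- The sample space
`X = ∏_{non-self-dual pairs} U(V) × ∏_{quaternionic} U(V) × ∏_{real} O(V_J)`. -/
abbrev X (D : BasisChoices irr S) : Type _ :=
  (∀ i : D.C, IsometryGroup ℂ (irr i).V) ×
  (∀ i : {i // (irr i).IsQuaternionicType}, IsometryGroup ℂ (irr i).V) ×
  (∀ i : {i // (irr i).IsRealType}, IsometryGroup ℝ ((irr i).realForm (D.JR i)))

open scoped Classical in
/-- The product of the Haar probability measures on `X`. -/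
def P [Fintype ι] (D : BasisChoices irr S) : Measure D.X :=
  (Measure.pi fun i : D.C => haarProb ℂ (irr i).V).prod
    ((Measure.pi fun i : {i // (irr i).IsQuaternionicType} => haarProb ℂ (irr i).V).prod
      (Measure.pi fun i : {i // (irr i).IsRealType} =>
        haarProb ℝ ((irr i).realForm (D.JR i))))

/-- Labels of the basis functions: for a non-self-dual pair `(k, j)` and a choice between real part
(`false`) and imaginary part (`true`), with `k, j ≤ dim V`; for a quaternionic representation the
same with `k ≤ dim V / 2`; for a real representation just `(k, j)`. -/
abbrev Index (D : BasisChoices irr S) : Type _ :=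
  (Σ i : D.C, Fin (irr i).dim × Fin (irr i).dim × Bool) ⊕
  (Σ i : {i // (irr i).IsQuaternionicType}, Fin ((irr i).dim / 2) × Fin (irr i).dim × Bool) ⊕
  (Σ i : {i // (irr i).IsRealType}, Fin (irr i).dim × Fin (irr i).dim)

/-- The random basis. With `w_j = u e_j` (or `w_j = o e_j` in the real case), its elements are
`√(2 dim V / |G|) Re ⟨π(g) v_k, w_j⟩` and `√(2 dim V / |G|) Im ⟨π(g) v_k, w_j⟩` in the
non-self-dual and quaternionic cases, and `√(dim V / |G|) ⟨π(g) v_k, w_j⟩` in the real case. -/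
def basis [Fintype G] (D : BasisChoices irr S) (x : D.X) : D.Index → EuclideanSpace ℂ G
  | .inl ⟨i, k, j, false⟩ => WithLp.toLp 2 fun g =>
      ((√(2 * (irr i).dim) / √(Fintype.card G) *
        ((irr i).coeff (D.vC i k) ((x.1 i).1 (D.eC i j)) g).re : ℝ) : ℂ)
  | .inl ⟨i, k, j, true⟩ => WithLp.toLp 2 fun g =>
      ((√(2 * (irr i).dim) / √(Fintype.card G) *
        ((irr i).coeff (D.vC i k) ((x.1 i).1 (D.eC i j)) g).im : ℝ) : ℂ)
  | .inr (.inl ⟨i, k, j, false⟩) => WithLp.toLp 2 fun g =>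
      ((√(2 * (irr i).dim) / √(Fintype.card G) *
        ((irr i).coeff (D.vQ i (Sum.inl k)) ((x.2.1 i).1 (D.eQ i j)) g).re : ℝ) : ℂ)
  | .inr (.inl ⟨i, k, j, true⟩) => WithLp.toLp 2 fun g =>
      ((√(2 * (irr i).dim) / √(Fintype.card G) *
        ((irr i).coeff (D.vQ i (Sum.inl k)) ((x.2.1 i).1 (D.eQ i j)) g).im : ℝ) : ℂ)
  | .inr (.inr ⟨i, k, j⟩) => WithLp.toLp 2 fun g =>
      ((√(irr i).dim / √(Fintype.card G) : ℝ) : ℂ) *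
        (irr i).coeff (D.vR i k : (irr i).V) ((x.2.2 i).1 (D.eR i j) : (irr i).V) g

end BasisChoices

end

/-!
The three families of basis functions all have the form `c · Re ⟨π(g) v, w⟩`, where `w` is
uniformly distributed on the unit sphere of a real inner product space `E` of dimension `n`: the
real space underlying `V`, with `n = 2 dim V`, or the real form `V_J`, with `n = dim V`
(`BasisChoices.basis_apply`).

*The basis.* Schur's lemma gives the orthogonality relations for matrix coefficients, with
conjugation (`UnitaryRep.sum_coeff_mul_conj_coeff_self`) and, through the dual representation,
without (`UnitaryRep.sum_coeff_mul_coeff_of_not_isDualOf`). A structure map `J` is automatically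
antiunitary, so that conjugating a coefficient amounts to applying `J` to both of its vectors. The
inner products of the real parts follow (`BasisChoices.sum_basis_mul_basis`). For completeness,
each coefficient of each irreducible representation is a combination of basis functions, and these
coefficients span `ℓ²(G)` (`UnitaryRep.span_coeff_eq_top`).

*Concentration.* The quantum mean of `f` in such a function is the value at `w` of the quadratic
form `∑ g, (n / |G|) f(g) ⟪π(g) v, ·⟫²`. Its normalised trace is the average of `f`, and its
Hilbert–Schmidt norm is at most `√n ‖f‖ / √|G|`, by Schur's test and orthogonality. Subtracting
the average yields a trace-free form `q`, and the event `|q(w)| > s τ ‖w‖²` is invariant under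
scaling, so that its probability may be computed for a standard Gaussian vector in place of `w`
(`haarProb_apply_mem_cone`). There the form is diagonal in an orthonormal basis, and the
exponential Markov inequality gives the bound `2 exp (1 / 8) exp (- t √n / 8)`
(`haarProb_weighted_frame_deviation`). A union bound over basis functions and the functions `f`
finishes the proof; the trivial representation contributes nothing, because its basis function is
constant.
-/

/-! ### A Chernoff bound for centred quadratic forms of Gaussian vectors -/

section
open ProbabilityTheory

lemma exp_neg_add_sq_le_one_sub {y : ℝ} (hy : |y| ≤ 1 / 2) : Real.exp (-(y + y ^ 2)) ≤ 1 - y := by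
  obtain ⟨h1, h2⟩ := abs_le.mp hy
  rcases le_total 0 y with h | h
  · have hq := Real.quadratic_le_exp_of_nonneg (x := y + y ^ 2) (by positivity)
    rw [Real.exp_neg, inv_le_comm₀ (Real.exp_pos _) (by linarith)]
    refine le_trans ?_ hq
    rw [inv_le_iff_one_le_mul₀ (by linarith)]
    nlinarith [mul_nonneg h h, mul_nonneg (mul_nonneg h h) (sub_nonneg.mpr h2),
      mul_nonneg (mul_nonneg h h) h, mul_nonneg (mul_nonneg (mul_nonneg h h) h) (sub_nonneg.mpr h2),
      mul_nonneg (mul_nonneg (mul_nonneg (mul_nonneg h h) h) h) (sub_nonneg.mpr h2)]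
  · have hq := Real.add_one_le_exp (y + y ^ 2)
    have hp : 0 < y + y ^ 2 + 1 := by nlinarith
    rw [Real.exp_neg, inv_le_comm₀ (Real.exp_pos _) (by linarith)]
    refine le_trans ?_ hq
    rw [inv_le_iff_one_le_mul₀ (by linarith)]
    nlinarith [mul_nonneg_of_nonpos_of_nonpos h h,
      mul_nonneg (mul_nonneg_of_nonpos_of_nonpos h h) (neg_nonneg.mpr h)]

lemma exp_half_le_one_add {y : ℝ} (h0 : 0 ≤ y) (h1 : y ≤ 1) : Real.exp (y / 2) ≤ 1 + y := by
  have hq := Real.add_one_le_exp (-(y / 2))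
  rw [Real.exp_neg] at hq
  rw [← inv_inv (Real.exp (y / 2)), inv_le_comm₀ (by positivity) (by linarith)]
  refine le_trans ?_ hq
  rw [inv_le_iff_one_le_mul₀ (by linarith)]
  nlinarith

lemma integrable_exp_mul_sq_gaussianReal {c : ℝ} (hc : c < 1 / 2) :
    Integrable (fun x : ℝ => Real.exp (c * x ^ 2)) (gaussianReal 0 1) := by
  rw [gaussianReal_of_var_ne_zero _ one_ne_zero,
    integrable_withDensity_iff_integrable_smul' (measurable_gaussianPDF _ _)
      (by simp [gaussianPDF])]
  have h := (integrable_exp_neg_mul_sq (b := 1 / 2 - c) (by linarith)).const_mul (√(2 * Real.pi))⁻¹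
  refine h.congr (.of_forall fun x => ?_)
  simp only [toReal_gaussianPDF, gaussianPDFReal, smul_eq_mul]
  rw [mul_assoc _ (Real.exp _), ← Real.exp_add]
  simp only [NNReal.coe_one, mul_one, sub_zero]
  ring_nf

lemma integral_exp_mul_sq_gaussianReal {c : ℝ} (hc : c < 1 / 2) :
    ∫ x : ℝ, Real.exp (c * x ^ 2) ∂gaussianReal 0 1 = (√(1 - 2 * c))⁻¹ := by
  rw [integral_gaussianReal_eq_integral_smul one_ne_zero]
  have h : ∀ x : ℝ, gaussianPDFReal 0 1 x • Real.exp (c * x ^ 2) =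
      (√(2 * Real.pi))⁻¹ * Real.exp (-(1 / 2 - c) * x ^ 2) := fun x => by
    simp only [gaussianPDFReal, smul_eq_mul]
    rw [mul_assoc _ (Real.exp _), ← Real.exp_add]
    simp only [NNReal.coe_one, mul_one, sub_zero]
    ring_nf
  simp_rw [h]
  rw [integral_const_mul, integral_gaussian, ← Real.sqrt_inv, ← Real.sqrt_inv,
    ← Real.sqrt_mul (by positivity)]
  congr 1
  have : 1 / 2 - c ≠ 0 := by linarith
  have : 1 - 2 * c ≠ 0 := by intro h; apply this; linarith
  field_simp

/-- Exponential Markov inequality for `∑ (a i - s τ) x i²` with parameter `1 / (4 τ)`. The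
subtracted multiple of `∑ x i²` supplies the factor `(1 + s / 2) ^ (-n / 2)`, so no separate lower
tail estimate for the norm of the Gaussian vector is needed. -/
lemma pi_gaussian_chernoff {ι : Type*} [Fintype ι] (a : ι → ℝ) (ha : ∑ i, a i = 0) {τ s : ℝ}
    (hτ : 0 < τ) (haτ : ∑ i, a i ^ 2 ≤ τ ^ 2) (hs : 0 < s) (hs1 : s ≤ 1) :
    (Measure.pi fun _ : ι => gaussianReal 0 1).real
      {x | s * τ * ∑ i, x i ^ 2 < ∑ i, a i * x i ^ 2} ≤
      Real.exp (1 / 8) * Real.exp (-(Fintype.card ι * s / 8)) := by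
  set c : ι → ℝ := fun i => a i / (4 * τ) - s / 4 with hc
  -- The Gaussian integrals involve `1 - 2 c i = (1 + s / 2) (1 - z i)`, where `∑ z i = 0`.
  set z : ι → ℝ := fun i => a i / (2 * τ * (1 + s / 2)) with hz
  have hai : ∀ i, |a i| ≤ τ := fun i => abs_le_of_sq_le_sq
    ((Finset.single_le_sum (f := fun i => a i ^ 2) (fun _ _ => sq_nonneg _)
      (Finset.mem_univ i)).trans haτ) hτ.le
  have hzi : ∀ i, |z i| ≤ 1 / 2 := fun i => by
    simp only [hz]
    rw [abs_div, abs_of_pos (by positivity : 0 < 2 * τ * (1 + s / 2)), div_le_iff₀ (by positivity)]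
    nlinarith [hai i, mul_pos hτ hs]
  have hcz : ∀ i, 1 - 2 * c i = (1 + s / 2) * (1 - z i) := fun i => by
    simp only [hc, hz]; field_simp; ring
  have hlow : ∀ i, Real.exp (s / 4 - (z i + z i ^ 2)) ≤ 1 - 2 * c i := fun i => by
    rw [hcz, sub_eq_add_neg, Real.exp_add]
    have := exp_half_le_one_add (y := s / 2) (by linarith) (by linarith)
    rw [div_div, show (2 : ℝ) * 2 = 4 by norm_num] at this
    exact mul_le_mul this (exp_neg_add_sq_le_one_sub (hzi i)) (Real.exp_pos _).le (by linarith)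
  have hc2 : ∀ i, c i < 1 / 2 := fun i => by
    have := (Real.exp_pos _).trans_le (hlow i); linarith
  have hint : Integrable (fun x : ι → ℝ => ∏ i, Real.exp (c i * x i ^ 2))
      (Measure.pi fun _ : ι => gaussianReal 0 1) :=
    Integrable.fintype_prod (f := fun i x => Real.exp (c i * x ^ 2))
      fun i => integrable_exp_mul_sq_gaussianReal (hc2 i)
  have hmarkov := mul_meas_ge_le_integral_of_nonneg
    (.of_forall fun x => Finset.prod_nonneg fun i _ => (Real.exp_pos _).le) hint 1
  rw [one_mul, integral_fintype_prod_eq_prod (f := fun i x => Real.exp (c i * x ^ 2))] at hmarkov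
  refine (measureReal_mono fun x hx => ?_).trans (hmarkov.trans ?_)
  · simp only [Set.mem_ofPred_eq] at hx ⊢
    rw [← Real.exp_sum]
    refine Real.one_le_exp ?_
    have : ∑ i, c i * x i ^ 2 = (∑ i, a i * x i ^ 2 - s * τ * ∑ i, x i ^ 2) / (4 * τ) := by
      rw [Finset.mul_sum, ← Finset.sum_sub_distrib, Finset.sum_div]
      refine Finset.sum_congr rfl fun i _ => ?_
      simp only [hc]; field_simp
    rw [this]
    exact div_nonneg (by linarith) (by linarith)
  · calc ∏ i, ∫ x : ℝ, Real.exp (c i * x ^ 2) ∂gaussianReal 0 1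
        ≤ ∏ i, Real.exp (-(s / 8) + (z i + z i ^ 2) / 2) := by
          refine Finset.prod_le_prod (fun i _ => integral_nonneg fun _ => (Real.exp_pos _).le)
            fun i _ => ?_
          rw [integral_exp_mul_sq_gaussianReal (hc2 i)]
          rw [inv_le_comm₀ (Real.sqrt_pos.mpr (by linarith [hc2 i])) (Real.exp_pos _),
            ← Real.exp_neg]
          refine Real.le_sqrt_of_sq_le ?_
          rw [← Real.exp_nat_mul]
          convert hlow i using 2
          push_cast; ring
      _ = Real.exp (∑ i, z i ^ 2 / 2) * Real.exp (-(Fintype.card ι * s / 8)) := by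
          have hz0 : ∑ i, z i = 0 := by simp only [hz]; rw [← Finset.sum_div, ha, zero_div]
          rw [← Real.exp_sum, ← Real.exp_add]
          congr 1
          rw [Finset.sum_add_distrib, ← Finset.sum_div, ← Finset.sum_div, Finset.sum_add_distrib,
            hz0]
          simp
          ring
      _ ≤ _ := by
          gcongr
          rw [← Finset.sum_div]
          have : ∑ i, z i ^ 2 = (∑ i, a i ^ 2) / (2 * τ * (1 + s / 2)) ^ 2 := by
            simp only [hz, div_pow]; rw [Finset.sum_div]
          have h2 : ∑ i, z i ^ 2 ≤ 1 / 4 := by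
            rw [this, div_le_iff₀ (by positivity)]
            refine haτ.trans ?_
            nlinarith [mul_pos (mul_pos hτ hτ) hs, mul_pos (mul_pos (mul_pos hτ hτ) hs) hs]
          linarith

/-- The quadratic form `x ↦ ∑ k, a k ⟪y k, x⟫²`, corrected by a multiple of `‖x‖²`. When the `y k`
are unit vectors, the correction makes the trace of the form zero. -/
noncomputable def centeredForm {E κ : Type*} [NormedAddCommGroup E] [InnerProductSpace ℝ E]
    [Fintype κ] (a : κ → ℝ) (y : κ → E) (x : E) : ℝ :=
  ∑ k, a k * inner ℝ (y k) x ^ 2 - (∑ k, a k) / Module.finrank ℝ E * ‖x‖ ^ 2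

section form
variable {E κ : Type*} [NormedAddCommGroup E] [InnerProductSpace ℝ E] [Fintype κ]

lemma continuous_centeredForm (a : κ → ℝ) (y : κ → E) : Continuous (centeredForm a y) := by
  unfold centeredForm; fun_prop

lemma centeredForm_neg (a : κ → ℝ) (y : κ → E) (x : E) :
    centeredForm (fun k => - a k) y x = - centeredForm a y x := by
  simp [centeredForm, Finset.sum_neg_distrib]; ring

lemma centeredForm_smul (a : κ → ℝ) (y : κ → E) (c : ℝ) (x : E) :
    centeredForm a y (c • x) = c ^ 2 * centeredForm a y x := by
  simp only [centeredForm, inner_smul_right, norm_smul, mul_pow, Real.norm_eq_abs, sq_abs]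
  rw [mul_sub, Finset.mul_sum]
  congr 1
  · exact Finset.sum_congr rfl fun _ _ => by ring
  · ring

/-- A centred form is diagonal in some orthonormal basis; its eigenvalues sum to zero, and the
sum of their squares is at most the squared Hilbert–Schmidt norm of the uncorrected form. -/
lemma exists_eigenbasis_centeredForm [FiniteDimensional ℝ E] [Nontrivial E]
    (a : κ → ℝ) (y : κ → E) (hy : ∀ k, ‖y k‖ = 1) :
    ∃ (b : OrthonormalBasis (Fin (Module.finrank ℝ E)) ℝ E) (c : Fin (Module.finrank ℝ E) → ℝ),
      (∀ x, centeredForm a y x = ∑ i, c i * inner ℝ (b i) x ^ 2) ∧ ∑ i, c i = 0 ∧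
      ∑ i, c i ^ 2 ≤ ∑ k, ∑ l, a k * a l * inner ℝ (y k) (y l) ^ 2 := by
  set n := Module.finrank ℝ E with hn
  have hn0 : (n : ℝ) ≠ 0 := by exact_mod_cast (Module.finrank_pos (R := ℝ) (M := E)).ne'
  set m : ℝ := (∑ k, a k) / n with hm
  let T : E →ₗ[ℝ] E := ∑ k, a k • ((innerₗ E (y k)).smulRight (y k))
  have hT : ∀ x, T x = ∑ k, (a k * inner ℝ (y k) x) • y k := fun x => by
    simp [T, LinearMap.sum_apply, smul_smul]
  have hTs : T.IsSymmetric := fun x z => by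
    rw [hT, hT, sum_inner, inner_sum]
    refine Finset.sum_congr rfl fun k _ => ?_
    rw [inner_smul_left, inner_smul_right, real_inner_comm (y k) x]
    simp; ring
  let b := hTs.eigenvectorBasis hn.symm
  let e := hTs.eigenvalues hn.symm
  have hb : ∀ i, T (b i) = e i • b i := fun i => hTs.apply_eigenvectorBasis hn.symm i
  have hxT : ∀ x, inner ℝ x (T x) = ∑ k, a k * inner ℝ (y k) x ^ 2 := fun x => by
    rw [hT, inner_sum]
    refine Finset.sum_congr rfl fun k _ => ?_
    rw [inner_smul_right, real_inner_comm]; ring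
  have hnorm : ∀ x, ∑ i, inner ℝ (b i) x ^ 2 = ‖x‖ ^ 2 := fun x => by
    have := b.sum_sq_norm_inner_right x
    simpa using this
  have hexp : ∀ x, inner ℝ x (T x) = ∑ i, e i * inner ℝ (b i) x ^ 2 := fun x => by
    rw [← b.sum_inner_mul_inner x (T x)]
    refine Finset.sum_congr rfl fun i _ => ?_
    rw [← hTs, hb, inner_smul_left, real_inner_comm]; simp; ring
  have he : ∀ i, e i = ∑ k, a k * inner ℝ (y k) (b i) ^ 2 := fun i => by
    rw [← hxT, hb, inner_smul_right, real_inner_self_eq_norm_sq, b.norm_eq_one]; simp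
  have hsum : ∑ i, e i = ∑ k, a k := by
    simp_rw [he]
    rw [Finset.sum_comm]
    refine Finset.sum_congr rfl fun k _ => ?_
    rw [← Finset.mul_sum]
    simp_rw [real_inner_comm (b _) (y k)]
    rw [hnorm, hy]; simp
  have hsq : ∑ i, e i ^ 2 = ∑ k, ∑ l, a k * a l * inner ℝ (y k) (y l) ^ 2 := by
    have h1 : ∀ i, e i ^ 2 = ∑ k, a k * (e i * inner ℝ (b i) (y k) ^ 2) := fun i => by
      rw [sq]; nth_rewrite 2 [he]; rw [Finset.mul_sum]
      refine Finset.sum_congr rfl fun k _ => ?_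
      rw [real_inner_comm]; ring
    simp_rw [h1]
    rw [Finset.sum_comm]
    refine Finset.sum_congr rfl fun k _ => ?_
    rw [← Finset.mul_sum, ← hexp, hxT, Finset.mul_sum]
    refine Finset.sum_congr rfl fun l _ => ?_
    rw [real_inner_comm]; ring
  have hmn : m * n = ∑ k, a k := by rw [hm]; field_simp
  refine ⟨b, fun i => e i - m, fun x => ?_, ?_, ?_⟩
  · simp_rw [sub_mul]
    rw [Finset.sum_sub_distrib, ← hexp, hxT, ← Finset.mul_sum, hnorm]; rfl
  · rw [Finset.sum_sub_distrib, hsum]; simp; rw [← hmn]; ring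
  · have : ∑ i, (e i - m) ^ 2 = ∑ i, e i ^ 2 - m ^ 2 * n := by
      simp_rw [sub_sq]
      rw [Finset.sum_add_distrib, Finset.sum_sub_distrib, ← Finset.sum_mul, ← Finset.mul_sum, hsum,
        ← hmn]
      simp; ring
    rw [this, hsq]
    have : 0 ≤ m ^ 2 * n := by positivity
    linarith

variable [FiniteDimensional ℝ E] [Nontrivial E] [MeasurableSpace E] [BorelSpace E]

lemma stdGaussian_centeredForm_one_sided (a : κ → ℝ) (y : κ → E) (hy : ∀ k, ‖y k‖ = 1) {τ s : ℝ}
    (hτ : 0 < τ) (haτ : ∑ k, ∑ l, a k * a l * inner ℝ (y k) (y l) ^ 2 ≤ τ ^ 2) (hs : 0 < s) :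
    (stdGaussian E).real {x | s * τ * ‖x‖ ^ 2 < centeredForm a y x} ≤
      Real.exp (1 / 8) * Real.exp (-(Module.finrank ℝ E * s / 8)) := by
  obtain ⟨b, c, hform, hc0, hc2⟩ := exists_eigenbasis_centeredForm a y hy
  have hc2' := hc2.trans haτ
  have hnorm : ∀ x, ∑ i, inner ℝ (b i) x ^ 2 = ‖x‖ ^ 2 := fun x => by
    simpa using b.sum_sq_norm_inner_right x
  -- For `s > 1` the event is empty, because every eigenvalue is at most `τ`.
  rcases le_or_gt s 1 with hs1 | hs1
  · rw [stdGaussian_eq_map_pi_orthonormalBasis b, map_measureReal_apply (by fun_prop)]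
    · have := pi_gaussian_chernoff c hc0 hτ hc2' hs hs1
      rw [Fintype.card_fin] at this
      convert this using 3
      ext x
      have hin : ∀ i, inner ℝ (b i) (∑ j, x j • b j) = x i := fun i => by
        simpa using b.orthonormal.inner_right_fintype x i
      simp only [Set.mem_preimage, Set.mem_ofPred_eq, hform, ← hnorm, hin]
    · exact measurableSet_lt (by fun_prop) (continuous_centeredForm a y).measurable
  · have : {x | s * τ * ‖x‖ ^ 2 < centeredForm a y x} = ∅ := by
      ext x
      simp only [Set.mem_ofPred_eq, Set.mem_empty_iff_false, iff_false, not_lt]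
      have hci : ∀ i, c i ≤ τ := fun i => (le_abs_self _).trans <| abs_le_of_sq_le_sq
        ((Finset.single_le_sum (f := fun i => c i ^ 2) (fun _ _ => sq_nonneg _)
          (Finset.mem_univ i)).trans hc2') hτ.le
      calc centeredForm a y x = ∑ i, c i * inner ℝ (b i) x ^ 2 := hform x
        _ ≤ ∑ i, τ * inner ℝ (b i) x ^ 2 := by gcongr; exact hci _
        _ = τ * ‖x‖ ^ 2 := by rw [← Finset.mul_sum, hnorm]
        _ ≤ s * τ * ‖x‖ ^ 2 := by nlinarith [mul_nonneg hτ.le (sq_nonneg ‖x‖)]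
    rw [this]
    simp; positivity

lemma stdGaussian_centeredForm (a : κ → ℝ) (y : κ → E) (hy : ∀ k, ‖y k‖ = 1) {τ s : ℝ}
    (hτ : 0 < τ) (haτ : ∑ k, ∑ l, a k * a l * inner ℝ (y k) (y l) ^ 2 ≤ τ ^ 2) (hs : 0 < s) :
    (stdGaussian E).real {x | s * τ * ‖x‖ ^ 2 < |centeredForm a y x|} ≤
      2 * (Real.exp (1 / 8) * Real.exp (-(Module.finrank ℝ E * s / 8))) := by
  have h1 := stdGaussian_centeredForm_one_sided a y hy hτ haτ hs
  have h2 := stdGaussian_centeredForm_one_sided (fun k => - a k) y hy hτ (by simpa using haτ) hs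
  have : {x | s * τ * ‖x‖ ^ 2 < |centeredForm a y x|} =
      {x | s * τ * ‖x‖ ^ 2 < centeredForm a y x} ∪
      {x | s * τ * ‖x‖ ^ 2 < centeredForm (fun k => - a k) y x} := by
    ext x; simp only [Set.mem_ofPred_eq, Set.mem_union, centeredForm_neg, lt_abs]
  rw [this]
  refine (measureReal_union_le _ _).trans ?_
  linarith
end form

end

/-! ### Haar-distributed isometries and Gaussian vectors -/

section
open ProbabilityTheory

section haar
variable {𝕜 : Type*} [RCLike 𝕜] {E : Type*} [NormedAddCommGroup E] [InnerProductSpace 𝕜 E]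

lemma continuous_isometryGroup_apply [CompleteSpace E] :
    Continuous fun p : IsometryGroup 𝕜 E × E => p.1.1 p.2 := by
  fun_prop

variable [FiniteDimensional 𝕜 E]

lemma exists_orthonormalBasis_apply_zero_eq {x : E} (hx : x ≠ 0) :
    ∃ b : OrthonormalBasis (Fin (Module.finrank 𝕜 E)) 𝕜 E,
      ∀ i : Fin (Module.finrank 𝕜 E), i.1 = 0 → b i = ((‖x‖⁻¹ : ℝ) : 𝕜) • x := by
  obtain ⟨b, hb⟩ := Orthonormal.exists_orthonormalBasis_extension_of_card_eq (𝕜 := 𝕜)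
    (ι := Fin (Module.finrank 𝕜 E)) (by simp) (v := fun _ => ((‖x‖⁻¹ : ℝ) : 𝕜) • x)
    (s := {i | i.1 = 0}) (by
      refine ⟨fun i => ?_, fun i j hij => ?_⟩
      · simp [norm_smul, norm_ne_zero_iff.mpr hx]
      · exact absurd (Subtype.ext (Fin.ext (i.2.trans j.2.symm))) hij)
  exact ⟨b, fun i hi => hb i hi⟩

variable [CompleteSpace E]

lemma exists_isometry_apply_eq {x z : E} (h : ‖x‖ = ‖z‖) :
    ∃ g : IsometryGroup 𝕜 E, g.1 x = z := by
  rcases eq_or_ne x 0 with rfl | hx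
  · exact ⟨1, by simpa [eq_comm] using h⟩
  have hz : z ≠ 0 := by rwa [← norm_ne_zero_iff, ← h, norm_ne_zero_iff]
  have : Nontrivial E := ⟨x, 0, hx⟩
  obtain ⟨b, hb⟩ := exists_orthonormalBasis_apply_zero_eq (𝕜 := 𝕜) hx
  obtain ⟨b', hb'⟩ := exists_orthonormalBasis_apply_zero_eq (𝕜 := 𝕜) hz
  let i : Fin (Module.finrank 𝕜 E) := ⟨0, Module.finrank_pos⟩
  refine ⟨Unitary.linearIsometryEquiv.symm (b.equiv b' (Equiv.refl _)), ?_⟩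
  rw [Unitary.coe_symm_linearIsometryEquiv_apply]
  have h1 := b.equiv_apply_basis b' (Equiv.refl _) i
  simp only [Equiv.refl_apply] at h1
  rw [hb i rfl, hb' i rfl, map_smul, h] at h1
  have h2 : ((‖z‖⁻¹ : ℝ) : 𝕜) ≠ 0 := by simpa using hz
  exact smul_right_injective _ h2 h1

instance isHaarMeasure_haarProb : (haarProb 𝕜 E).IsHaarMeasure := by
  unfold haarProb; infer_instance

instance isProbabilityMeasure_haarProb : IsProbabilityMeasure (haarProb 𝕜 E) :=
  ⟨by
    simpa [haarProb] using Measure.haarMeasure_self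
      (K₀ := (⊤ : TopologicalSpace.PositiveCompacts (IsometryGroup 𝕜 E)))⟩

instance isMulRightInvariant_haarProb : (haarProb 𝕜 E).IsMulRightInvariant := by
  refine ⟨fun g => ?_⟩
  have : IsProbabilityMeasure ((haarProb 𝕜 E).map (· * g)) :=
    Measure.isProbabilityMeasure_map (by fun_prop)
  have : ((haarProb 𝕜 E).map (· * g)).IsHaarMeasure := inferInstance
  exact Measure.isHaarMeasure_eq_of_isProbabilityMeasure _ _

/-- The law of `g x` for Haar-distributed `g` depends only on `‖x‖`. -/
lemma haarProb_apply_mem_congr {x z : E} (h : ‖x‖ = ‖z‖) (A : Set E) :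
    haarProb 𝕜 E {g | g.1 x ∈ A} = haarProb 𝕜 E {g | g.1 z ∈ A} := by
  obtain ⟨k, rfl⟩ := exists_isometry_apply_eq (𝕜 := 𝕜) h
  exact (measure_preimage_mul_right (haarProb 𝕜 E) k {g | g.1 x ∈ A}).symm

end haar

section real
variable {E : Type*} [NormedAddCommGroup E] [InnerProductSpace ℝ E] [FiniteDimensional ℝ E]
  [MeasurableSpace E] [BorelSpace E]

lemma ae_stdGaussian_ne_zero [Nontrivial E] : ∀ᵐ x ∂stdGaussian E, x ≠ 0 := by
  let b := stdOrthonormalBasis ℝ E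
  have hpos : 0 < Module.finrank ℝ E := Module.finrank_pos
  let i : Fin (Module.finrank ℝ E) := ⟨0, hpos⟩
  rw [stdGaussian_eq_map_pi_orthonormalBasis b,
    ae_map_iff (p := fun x => x ≠ 0) (Measurable.aemeasurable (by fun_prop))
      (measurableSet_singleton 0).compl]
  have h : ∀ᵐ t ∂gaussianReal 0 1, t ≠ 0 := by
    have := nullSingletonClass_gaussianReal (μ := 0) (v := 1) one_ne_zero
    exact Measure.ae_ne _ 0
  have h2 := (measurePreserving_eval (fun _ : Fin (Module.finrank ℝ E) => gaussianReal 0 1)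
    i).quasiMeasurePreserving.ae h
  filter_upwards [h2] with x hx hx0
  apply hx
  have : inner ℝ (b i) (∑ j, x j • b j) = x i := by
    simpa using b.orthonormal.inner_right_fintype x i
  rw [hx0, inner_zero_right] at this
  exact this.symm

variable {𝕜 : Type*} [RCLike 𝕜] [InnerProductSpace 𝕜 E] [CompleteSpace E]

/-- The standard Gaussian is invariant under the isometries of another inner product structure
with the same norm; for `𝕜 = ℂ` this is the invariance of a real Gaussian under the unitary group.
-/
lemma stdGaussian_isometry_mem (g : IsometryGroup 𝕜 E) {A : Set E} (hA : MeasurableSet A) :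
    stdGaussian E {x | g.1 x ∈ A} = stdGaussian E A := by
  let f : E →ₗᵢ[ℝ] E :=
    { toLinearMap := (AddMonoidHom.toRealLinearMap (g.1 : E →+ E) g.1.continuous).toLinearMap
      norm_map' := fun x => ContinuousLinearMap.norm_map_of_mem_unitary g.2 x }
  let F : E ≃ₗᵢ[ℝ] E := f.toLinearIsometryEquiv rfl
  have hF : ∀ x, F x = g.1 x := fun x => rfl
  have := stdGaussian_map F
  conv_rhs => rw [← this]
  rw [Measure.map_apply F.continuous.measurable hA]
  rfl

/-- For Haar-distributed `g`, the vector `g e` hits a cone with the same probability as a standard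
Gaussian vector. This follows from Fubini applied to `g x` with `g` and `x` independent: given `g`
the law is Gaussian, and given `x ≠ 0` the probability does not depend on `x`. -/
lemma haarProb_apply_mem_cone [FiniteDimensional 𝕜 E] [Nontrivial E] {A : Set E}
    (hA : MeasurableSet A)
    (hcone : ∀ (c : ℝ) (x : E), 0 < c → c • x ∈ A → x ∈ A) {e : E} (he : e ≠ 0) :
    haarProb 𝕜 E {g | g.1 e ∈ A} = stdGaussian E A := by
  have hB : MeasurableSet {p : IsometryGroup 𝕜 E × E | p.1.1 p.2 ∈ A} :=
    continuous_isometryGroup_apply.measurable hA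
  have h1 := Measure.prod_apply (μ := haarProb 𝕜 E) (ν := stdGaussian E) hB
  have h2 := Measure.prod_apply_symm (μ := haarProb 𝕜 E) (ν := stdGaussian E) hB
  have h1' : ∀ g : IsometryGroup 𝕜 E, stdGaussian E
      (Prod.mk g ⁻¹' {p : IsometryGroup 𝕜 E × E | p.1.1 p.2 ∈ A}) = stdGaussian E A :=
    fun g => stdGaussian_isometry_mem g hA
  have hsub : ∀ (x z : E), x ≠ 0 → z ≠ 0 → haarProb 𝕜 E {g | g.1 x ∈ A} ≤
      haarProb 𝕜 E {g | g.1 z ∈ A} := fun x z hx hz => by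
    have hpos : 0 < ‖x‖ / ‖z‖ := by positivity
    have hn : ‖x‖ = ‖(‖x‖ / ‖z‖) • z‖ := by
      rw [norm_smul, Real.norm_of_nonneg hpos.le]; field_simp
    rw [haarProb_apply_mem_congr hn]
    refine measure_mono fun g hg => ?_
    simp only [Set.mem_ofPred_eq] at hg ⊢
    rw [map_real_smul g.1 g.1.continuous] at hg
    exact hcone _ _ hpos hg
  have h2' : ∀ᵐ x ∂stdGaussian E, haarProb 𝕜 E
      ((fun g => (g, x)) ⁻¹' {p : IsometryGroup 𝕜 E × E | p.1.1 p.2 ∈ A}) =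
      haarProb 𝕜 E {g | g.1 e ∈ A} := by
    filter_upwards [ae_stdGaussian_ne_zero (E := E)] with x hx
    exact le_antisymm (hsub x e hx he) (hsub e x he hx)
  simp_rw [h1'] at h1
  rw [lintegral_congr_ae h2', h1] at h2
  simpa using h2.symm

end real

section conc
variable {E κ : Type*} [NormedAddCommGroup E] [InnerProductSpace ℝ E] [FiniteDimensional ℝ E]
  [Nontrivial E] [Fintype κ]
variable {𝕜 : Type*} [RCLike 𝕜] [InnerProductSpace 𝕜 E] [FiniteDimensional 𝕜 E] [CompleteSpace E]

theorem haarProb_centeredForm (a : κ → ℝ) (y : κ → E) (hy : ∀ k, ‖y k‖ = 1) {τ s : ℝ}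
    (hτ : 0 < τ) (haτ : ∑ k, ∑ l, a k * a l * inner ℝ (y k) (y l) ^ 2 ≤ τ ^ 2) (hs : 0 < s)
    {e : E} (he : ‖e‖ = 1) :
    (haarProb 𝕜 E).real {g | s * τ < |centeredForm a y (g.1 e)|} ≤
      2 * (Real.exp (1 / 8) * Real.exp (-(Module.finrank ℝ E * s / 8))) := by
  borelize E
  refine le_trans (le_of_eq ?_) (stdGaussian_centeredForm a y hy hτ haτ hs)
  rw [measureReal_def, measureReal_def]
  congr 1
  rw [← haarProb_apply_mem_cone (𝕜 := 𝕜) _ _ (norm_ne_zero_iff.mp (he ▸ one_ne_zero))]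
  · congr 1
    ext g
    simp [ContinuousLinearMap.norm_map_of_mem_unitary g.2, he]
  · exact measurableSet_lt (by fun_prop) (continuous_centeredForm a y).abs.measurable
  · intro c x hc hx
    simp only [Set.mem_ofPred_eq, norm_smul, mul_pow, centeredForm_smul, abs_mul,
      Real.norm_eq_abs, sq_abs, abs_pow] at hx ⊢
    have : 0 < c ^ 2 := by positivity
    nlinarith
end conc

end

/-! ### Deviation of weighted frames -/

section
open ProbabilityTheory

/-- Schur's test for a nonnegative symmetric kernel. -/
lemma sum_sum_mul_le_of_row_sums {κ : Type*} [Fintype κ] (a : κ → ℝ) (K : κ → κ → ℝ)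
    (hK : ∀ k l, 0 ≤ K k l) (hsymm : ∀ k l, K k l = K l k) {r : ℝ} (hrow : ∀ k, ∑ l, K k l ≤ r) :
    ∑ k, ∑ l, a k * a l * K k l ≤ r * ∑ k, a k ^ 2 := by
  have h1 : ∑ k, ∑ l, a k ^ 2 * K k l ≤ r * ∑ k, a k ^ 2 := by
    rw [Finset.mul_sum]
    refine Finset.sum_le_sum fun k _ => ?_
    rw [← Finset.mul_sum, mul_comm r]
    exact mul_le_mul_of_nonneg_left (hrow k) (sq_nonneg _)
  have h2 : ∑ k, ∑ l, a l ^ 2 * K k l = ∑ k, ∑ l, a k ^ 2 * K k l := by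
    rw [Finset.sum_comm]
    simp_rw [hsymm]
  calc ∑ k, ∑ l, a k * a l * K k l
      ≤ ∑ k, ∑ l, (a k ^ 2 * K k l + a l ^ 2 * K k l) / 2 := by
        refine Finset.sum_le_sum fun k _ => Finset.sum_le_sum fun l _ => ?_
        nlinarith [mul_nonneg (hK k l) (sq_nonneg (a k - a l))]
    _ = ∑ k, ∑ l, a k ^ 2 * K k l := by
        simp_rw [← Finset.sum_div, Finset.sum_add_distrib]
        rw [h2]; ring
    _ ≤ _ := h1

section conc
variable {E κ : Type*} [NormedAddCommGroup E] [InnerProductSpace ℝ E] [FiniteDimensional ℝ E]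
  [Nontrivial E] [Fintype κ] [Nonempty κ]
variable {𝕜 : Type*} [RCLike 𝕜] [InnerProductSpace 𝕜 E] [FiniteDimensional 𝕜 E] [CompleteSpace E]

/-- Concentration of `∑ k, f k ⟪y k, w⟫²` around its mean for `w` uniform on the unit sphere. The
row sum hypothesis bounds the Hilbert–Schmidt norm of this form by Schur's test. -/
theorem haarProb_weighted_frame_deviation (y : κ → E) (hy : ∀ k, ‖y k‖ = 1)
    (hrow : ∀ k, ∑ l, inner ℝ (y k) (y l) ^ 2 ≤ Fintype.card κ / Module.finrank ℝ E)
    (f : EuclideanSpace ℝ κ) {t : ℝ} (ht : 0 < t) {e : E} (he : ‖e‖ = 1) :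
    (haarProb 𝕜 E).real {u | t * (‖f‖ / √(Fintype.card κ)) <
        |∑ k, (Module.finrank ℝ E / Fintype.card κ * inner ℝ (y k) (u.1 e) ^ 2) * f k -
          (∑ k, f k) / Fintype.card κ|} ≤
      2 * (Real.exp (1 / 8) * Real.exp (-(t * √(Module.finrank ℝ E) / 8))) := by
  rcases eq_or_ne f 0 with rfl | hf
  · simp; positivity
  set n : ℝ := (Module.finrank ℝ E : ℝ) with hn
  have hn0 : 0 < n := by rw [hn]; exact_mod_cast (Module.finrank_pos (R := ℝ) (M := E))
  set N : ℝ := (Fintype.card κ : ℝ) with hN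
  have hN0 : 0 < N := by rw [hN]; exact_mod_cast Fintype.card_pos
  have hf0 : 0 < ‖f‖ := norm_pos_iff.mpr hf
  have hsn : 0 < √n := Real.sqrt_pos.mpr hn0
  have hsN : 0 < √N := Real.sqrt_pos.mpr hN0
  have hsn2 : √n ^ 2 = n := Real.sq_sqrt hn0.le
  have hsN2 : √N ^ 2 = N := Real.sq_sqrt hN0.le
  have hHS : ∑ k, ∑ l, (n / N * f k) * (n / N * f l) * inner ℝ (y k) (y l) ^ 2 ≤
      (√n * ‖f‖ / √N) ^ 2 := by
    refine (sum_sum_mul_le_of_row_sums _ _ (fun _ _ => sq_nonneg _)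
      (fun k l => by rw [real_inner_comm]) hrow).trans (le_of_eq ?_)
    simp_rw [mul_pow, ← Finset.mul_sum]
    simp only [div_pow, mul_pow]
    rw [hsn2, hsN2, EuclideanSpace.real_norm_sq_eq]
    field_simp
  have := haarProb_centeredForm (𝕜 := 𝕜) (fun k => n / N * f k) y hy (τ := √n * ‖f‖ / √N)
    (s := t / √n) (by positivity) hHS (by positivity) he
  convert this using 3
  · ext u
    have h1 : t / √n * (√n * ‖f‖ / √N) = t * (‖f‖ / √N) := by field_simp
    have h2 : centeredForm (fun k => n / N * f k) y (u.1 e) =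
        ∑ k, (n / N * inner ℝ (y k) (u.1 e) ^ 2) * f k - (∑ k, f k) / N := by
      rw [centeredForm, ContinuousLinearMap.norm_map_of_mem_unitary u.2, he, ← Finset.mul_sum,
        ← hn]
      congr 1
      · exact Finset.sum_congr rfl fun k _ => by ring
      · field_simp
    rw [h1, h2]
  · congr 2
    rw [← hn, mul_div_assoc' , ← hsn2]
    field_simp
    rw [Real.sqrt_sq hsn.le]
end conc

end

/-! ### Schur's lemma, dual representations and structure maps -/

namespace UnitaryRep

open scoped ComplexConjugate

section general
variable {G : Type v} [Group G]

lemma π_mul_apply (R : UnitaryRep.{v, w} G) (g h : G) (x : R.V) :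
    R.π (g * h) x = R.π g (R.π h x) := by
  rw [map_mul]; rfl

lemma inner_π_left (R : UnitaryRep.{v, w} G) (g : G) (x y : R.V) :
    inner ℂ (R.π g x) y = inner ℂ x (R.π g⁻¹ y) := by
  rw [← (R.π g⁻¹).inner_map_map (R.π g x) y, ← π_mul_apply, inv_mul_cancel, map_one]
  rfl

lemma isIrreducible_iff (R : UnitaryRep.{v, w} G) : R.IsIrreducible ↔
    Nontrivial R.V ∧ ∀ U : Submodule ℂ R.V, (∀ g, ∀ x ∈ U, R.π g x ∈ U) → U = ⊥ ∨ U = ⊤ := by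
  constructor
  · intro h
    have h : IsSimpleOrder (Subrepresentation R.toRepresentation) := h
    refine ⟨?_, fun U hU => ?_⟩
    · by_contra hn
      rw [not_nontrivial_iff_subsingleton] at hn
      apply bot_ne_top (α := Subrepresentation R.toRepresentation)
      apply Subrepresentation.toSubmodule_injective
      exact Subsingleton.elim _ _
    · rcases h.eq_bot_or_eq_top ⟨U, fun g x hx => hU g x hx⟩ with h | h
      · exact .inl (congrArg Subrepresentation.toSubmodule h)
      · exact .inr (congrArg Subrepresentation.toSubmodule h)
  · rintro ⟨hn, h⟩
    refine @IsSimpleOrder.mk _ _ _ ⟨⊥, ⊤, fun hbt => ?_⟩ fun U => ?_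
    · exact bot_ne_top (α := Submodule ℂ R.V) (congrArg Subrepresentation.toSubmodule hbt)
    · rcases h U.toSubmodule fun g x hx => U.apply_mem_toSubmodule g hx with h | h
      · exact .inl (Subrepresentation.toSubmodule_injective h)
      · exact .inr (Subrepresentation.toSubmodule_injective h)

lemma IsIrreducible.nontrivial {R : UnitaryRep.{v, w} G} (hR : R.IsIrreducible) :
    Nontrivial R.V := (R.isIrreducible_iff.mp hR).1

lemma IsIrreducible.injective_of_ne_zero {R : UnitaryRep.{v, w} G} {R' : UnitaryRep.{v, u} G}
    (hR : R.IsIrreducible) {T : R.V →ₗ[ℂ] R'.V} (hT : ∀ g x, T (R.π g x) = R'.π g (T x))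
    (h0 : T ≠ 0) : Function.Injective T := by
  rcases (R.isIrreducible_iff.mp hR).2 (LinearMap.ker T) fun g x hx => by
    rw [LinearMap.mem_ker] at hx ⊢; rw [hT, hx, map_zero] with h | h
  · exact LinearMap.ker_eq_bot.mp h
  · exact absurd (LinearMap.ker_eq_top.mp h) h0

lemma IsIrreducible.surjective_of_ne_zero {R : UnitaryRep.{v, w} G} {R' : UnitaryRep.{v, u} G}
    (hR' : R'.IsIrreducible) {T : R.V →ₗ[ℂ] R'.V} (hT : ∀ g x, T (R.π g x) = R'.π g (T x))
    (h0 : T ≠ 0) : Function.Surjective T := by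
  rcases (R'.isIrreducible_iff.mp hR').2 (LinearMap.range T) fun g x hx => by
    obtain ⟨z, rfl⟩ := hx; exact ⟨R.π g z, hT g z⟩ with h | h
  · exact absurd (LinearMap.range_eq_bot.mp h) h0
  · exact LinearMap.range_eq_top.mp h

/-- Schur's lemma: a self-intertwiner of an irreducible representation is a scalar. -/
lemma IsIrreducible.exists_eq_smul {R : UnitaryRep.{v, w} G} (hR : R.IsIrreducible)
    {T : R.V →ₗ[ℂ] R.V} (hT : ∀ g x, T (R.π g x) = R.π g (T x)) :
    ∃ c : ℂ, ∀ x, T x = c • x := by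
  have := hR.nontrivial
  obtain ⟨c, hc⟩ := Module.End.exists_eigenvalue T
  refine ⟨c, fun x => ?_⟩
  rcases (R.isIrreducible_iff.mp hR).2 (Module.End.eigenspace T c) fun g x hx => by
    rw [Module.End.mem_eigenspace_iff] at hx ⊢; rw [hT, hx, map_smul] with h | h
  · exact absurd h hc
  · exact Module.End.mem_eigenspace_iff.mp (h ▸ Submodule.mem_top)

/-- A nonzero intertwiner out of an irreducible representation is a multiple of an isometry, since
`T* T` is scalar by Schur's lemma. -/
lemma IsIrreducible.exists_norm_eq_mul {R : UnitaryRep.{v, w} G} {R' : UnitaryRep.{v, u} G}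
    (hR : R.IsIrreducible) {T : R.V →ₗ[ℂ] R'.V} (hT : ∀ g x, T (R.π g x) = R'.π g (T x))
    (h0 : T ≠ 0) : ∃ r : ℝ, 0 < r ∧ ∀ x, ‖T x‖ = r * ‖x‖ := by
  have := hR.nontrivial
  have hinj := hR.injective_of_ne_zero hT h0
  have hadj : ∀ g y, T.adjoint (R'.π g y) = R.π g (T.adjoint y) := fun g y => by
    refine ext_inner_right ℂ fun x => ?_
    rw [LinearMap.adjoint_inner_left, inner_π_left, inner_π_left, LinearMap.adjoint_inner_left, hT]
  obtain ⟨c, hc⟩ := hR.exists_eq_smul (T := T.adjoint ∘ₗ T) fun g x => by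
    simp only [LinearMap.comp_apply, hT, hadj]
  have hsq : ∀ x, ‖T x‖ ^ 2 = c.re * ‖x‖ ^ 2 := fun x => by
    have h1 : inner ℂ x (c • x) = inner ℂ (T x) (T x) := by
      rw [← hc, LinearMap.comp_apply, LinearMap.adjoint_inner_right]
    rw [inner_smul_right, inner_self_eq_norm_sq_to_K, inner_self_eq_norm_sq_to_K] at h1
    have h2 := congrArg Complex.re h1
    simpa [Complex.mul_re, ← Complex.ofReal_pow] using h2.symm
  obtain ⟨x, hx⟩ := exists_ne (0 : R.V)
  have hTx : T x ≠ 0 := fun h => hx (hinj (h.trans (map_zero T).symm))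
  have hcpos : 0 < c.re := by
    have h1 : 0 < ‖T x‖ ^ 2 := by positivity
    rw [hsq] at h1
    exact pos_of_mul_pos_left h1 (by positivity)
  refine ⟨√c.re, Real.sqrt_pos.mpr hcpos, fun x => ?_⟩
  rw [← Real.sqrt_sq (norm_nonneg (T x)), hsq, Real.sqrt_mul hcpos.le,
    Real.sqrt_sq (norm_nonneg x)]

lemma IsIrreducible.equivalent_of_ne_zero {R : UnitaryRep.{v, w} G} {R' : UnitaryRep.{v, u} G}
    (hR : R.IsIrreducible) (hR' : R'.IsIrreducible) {T : R.V →ₗ[ℂ] R'.V}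
    (hT : ∀ g x, T (R.π g x) = R'.π g (T x)) (h0 : T ≠ 0) : R.Equivalent R' := by
  obtain ⟨r, hr, hrT⟩ := hR.exists_norm_eq_mul hT h0
  have hbij : Function.Bijective (((r⁻¹ : ℝ) : ℂ) • T) := by
    have h1 : Function.Bijective T :=
      ⟨hR.injective_of_ne_zero hT h0, hR'.surjective_of_ne_zero hT h0⟩
    have hr' : ((r⁻¹ : ℝ) : ℂ) ≠ 0 := by simpa using hr.ne'
    refine ⟨fun x y h => h1.1 (smul_right_injective _ hr' h), fun y => ?_⟩
    obtain ⟨x, hx⟩ := h1.2 ((r : ℂ) • y)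
    refine ⟨x, ?_⟩
    rw [LinearMap.smul_apply, hx, smul_smul, ← Complex.ofReal_mul, inv_mul_cancel₀ hr.ne']
    simp
  refine ⟨⟨LinearEquiv.ofBijective _ hbij, fun x => ?_⟩, fun g x => ?_⟩
  · simp only [LinearEquiv.ofBijective_apply, LinearMap.smul_apply, norm_smul, hrT,
      Complex.norm_real, norm_inv, Real.norm_of_nonneg hr.le]
    field_simp
  · change ((r⁻¹ : ℝ) : ℂ) • T (R.π g x) = R'.π g (((r⁻¹ : ℝ) : ℂ) • T x)
    rw [hT, map_smul]

lemma Equivalent.symm {R : UnitaryRep.{v, w} G} {R' : UnitaryRep.{v, u} G} (h : R.Equivalent R') :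
    R'.Equivalent R := by
  obtain ⟨T, hT⟩ := h
  refine ⟨T.symm, fun g y => ?_⟩
  rw [LinearIsometryEquiv.symm_apply_eq, hT, T.apply_symm_apply]

/-- The inner product on the dual space for which `v ↦ ⟪v, ·⟫` is a conjugate-linear isometry. It
induces the dual norm. -/
@[reducible] noncomputable def dualInnerProductSpace (R : UnitaryRep.{v, w} G) :
    InnerProductSpace ℂ (StrongDual ℂ R.V) where
  inner α β := inner ℂ ((InnerProductSpace.toDual ℂ R.V).symm β)
    ((InnerProductSpace.toDual ℂ R.V).symm α)
  norm_sq_eq_re_inner α := by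
    rw [inner_self_eq_norm_sq, LinearIsometryEquiv.norm_map]
  conj_inner_symm α β := inner_conj_symm _ _
  add_left α β γ := by rw [map_add, inner_add_right]
  smul_left α β c := by
    rw [LinearIsometryEquiv.map_smulₛₗ, inner_smul_right]

/-- The dual representation, on the dual space with its dual norm. The action is transported along
`v ↦ ⟪v, ·⟫`; by unitarity it is `α ↦ α ∘ π(g⁻¹)`. -/
noncomputable def dual (R : UnitaryRep.{v, w} G) : UnitaryRep.{v, w} G where
  V := StrongDual ℂ R.V
  instInnerProductSpace := R.dualInnerProductSpace
  instFiniteDimensional := (inferInstance : FiniteDimensional ℂ (StrongDual ℂ R.V))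
  π :=
    { toFun := fun g => ((InnerProductSpace.toDual ℂ R.V).symm.trans (R.π g)).trans
        (InnerProductSpace.toDual ℂ R.V)
      map_one' := by
        refine LinearIsometryEquiv.ext fun α => ?_
        change InnerProductSpace.toDual ℂ R.V (R.π 1 ((InnerProductSpace.toDual ℂ R.V).symm α)) = α
        simp
      map_mul' := fun g h => by
        refine LinearIsometryEquiv.ext fun α => ?_
        change InnerProductSpace.toDual ℂ R.V
          (R.π (g * h) ((InnerProductSpace.toDual ℂ R.V).symm α)) =
          InnerProductSpace.toDual ℂ R.V (R.π g ((InnerProductSpace.toDual ℂ R.V).symm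
            (InnerProductSpace.toDual ℂ R.V (R.π h ((InnerProductSpace.toDual ℂ R.V).symm α)))))
        rw [LinearIsometryEquiv.symm_apply_apply, π_mul_apply] }

/-- The conjugate-linear isometry `v ↦ ⟪v, ·⟫` onto the dual representation. -/
noncomputable def toDual (R : UnitaryRep.{v, w} G) : R.V ≃ₗᵢ⋆[ℂ] R.dual.V :=
  InnerProductSpace.toDual ℂ R.V

lemma dual_π_toDual (R : UnitaryRep.{v, w} G) (g : G) (x : R.V) :
    R.dual.π g (R.toDual x) = R.toDual (R.π g x) := by
  change (InnerProductSpace.toDual ℂ R.V) (R.π g ((InnerProductSpace.toDual ℂ R.V).symm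
    ((InnerProductSpace.toDual ℂ R.V) x))) = _
  rw [LinearIsometryEquiv.symm_apply_apply]; rfl

lemma inner_toDual (R : UnitaryRep.{v, w} G) (x y : R.V) :
    inner ℂ (R.toDual x) (R.toDual y) = inner ℂ y x := by
  change inner ℂ ((InnerProductSpace.toDual ℂ R.V).symm ((InnerProductSpace.toDual ℂ R.V) y))
    ((InnerProductSpace.toDual ℂ R.V).symm ((InnerProductSpace.toDual ℂ R.V) x)) = _
  simp

lemma coeff_dual (R : UnitaryRep.{v, w} G) (x y : R.V) (g : G) :
    R.dual.coeff (R.toDual x) (R.toDual y) g = conj (R.coeff x y g) := by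
  rw [coeff, coeff, dual_π_toDual, inner_toDual, inner_conj_symm]

lemma isDualOf_iff {R' R : UnitaryRep.{v, w} G} : R'.IsDualOf R ↔ R'.Equivalent R.dual := by
  have key : ∀ (g : G) (α : StrongDual ℂ R.V) (x : R.V),
      (show StrongDual ℂ R.V from R.dual.π g α) x = α (R.π g⁻¹ x) := fun g α x => by
    obtain ⟨y, rfl⟩ := (InnerProductSpace.toDual ℂ R.V).surjective α
    have := R.dual_π_toDual g y
    erw [this]
    exact R.inner_π_left g y x
  constructor
  · rintro ⟨T, hT⟩
    refine ⟨T, fun g y => ?_⟩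
    refine ContinuousLinearMap.ext fun x => ?_
    exact (hT g y x).trans (key g (T y) x).symm
  · rintro ⟨T, hT⟩
    refine ⟨T, fun g y x => ?_⟩
    exact (congrArg (fun α : StrongDual ℂ R.V => α x) (hT g y)).trans (key g (T y) x)

lemma IsIrreducible.dual {R : UnitaryRep.{v, w} G} (hR : R.IsIrreducible) :
    R.dual.IsIrreducible := by
  rw [isIrreducible_iff] at hR ⊢
  obtain ⟨hn, h⟩ := hR
  refine ⟨R.toDual.injective.nontrivial, fun U hU => ?_⟩
  have hmem : ∀ x, x ∈ U.comap R.toDual.toLinearEquiv.toLinearMap ↔ R.toDual x ∈ U :=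
    fun x => Iff.rfl
  rcases h (U.comap R.toDual.toLinearEquiv.toLinearMap) fun g x hx => by
    rw [hmem] at hx ⊢; rw [← dual_π_toDual]; exact hU g _ hx with h | h
  · refine .inl ((Submodule.eq_bot_iff _).mpr fun α hα => ?_)
    obtain ⟨x, rfl⟩ := R.toDual.surjective α
    rw [← hmem, h, Submodule.mem_bot] at hα
    rw [hα, map_zero]
  · refine .inr ((Submodule.eq_top_iff').mpr fun α => ?_)
    obtain ⟨x, rfl⟩ := R.toDual.surjective α
    rw [← hmem, h]; trivial

/-- The linear map `x ↦ ⟪J x, ·⟫` into the dual that a conjugate-linear map `J` gives. -/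
noncomputable def conjToDual (R : UnitaryRep.{v, w} G) (J : R.V →ₛₗ[starRingEnd ℂ] R.V) :
    R.V →ₗ[ℂ] R.dual.V :=
  R.toDual.toLinearEquiv.toLinearMap.comp J

lemma conjToDual_apply (R : UnitaryRep.{v, w} G) (J : R.V →ₛₗ[starRingEnd ℂ] R.V) (x : R.V) :
    R.conjToDual J x = R.toDual (J x) := rfl

/-- Structure maps are isometric, although the definition does not ask for it: Schur's lemma makes
`J` a multiple `r` of an isometry, and `J² = ε` forces `r² = 1`. -/
lemma IsStructureMap.norm_map {R : UnitaryRep.{v, w} G} (hR : R.IsIrreducible) {ε : ℂ}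
    (hε : ‖ε‖ = 1) {J : R.V →ₛₗ[starRingEnd ℂ] R.V} (hJ : R.IsStructureMap ε J) (x : R.V) :
    ‖J x‖ = ‖x‖ := by
  have := hR.nontrivial
  obtain ⟨z, hz⟩ := exists_ne (0 : R.V)
  have hJJ : ∀ y, ‖J (J y)‖ = ‖y‖ := fun y => by rw [hJ.2, norm_smul, hε, one_mul]
  obtain ⟨r, hr, hrJ⟩ := hR.exists_norm_eq_mul (T := R.conjToDual J)
    (fun g x => by rw [conjToDual_apply, conjToDual_apply, dual_π_toDual, hJ.1]) (fun h0 => hz <| by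
      have h1 : R.toDual (J z) = 0 := by rw [← conjToDual_apply, h0]; rfl
      rw [← norm_eq_zero, LinearIsometryEquiv.norm_map, norm_eq_zero] at h1
      rw [← norm_eq_zero, ← hJJ, h1, map_zero, norm_zero])
  simp only [conjToDual_apply, LinearIsometryEquiv.norm_map] at hrJ
  have h1 := hJJ z
  rw [hrJ, hrJ, ← mul_assoc] at h1
  have h2 : r * r = 1 := by
    have : 0 < ‖z‖ := norm_pos_iff.mpr hz
    nlinarith
  rw [hrJ, show r = 1 by nlinarith, one_mul]

lemma IsStructureMap.inner_map {R : UnitaryRep.{v, w} G} (hR : R.IsIrreducible) {ε : ℂ}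
    (hε : ‖ε‖ = 1) {J : R.V →ₛₗ[starRingEnd ℂ] R.V} (hJ : R.IsStructureMap ε J) (x y : R.V) :
    inner ℂ (J x) (J y) = inner ℂ y x := by
  let L : R.V →ₗᵢ[ℂ] R.dual.V := ⟨R.conjToDual J, fun x => by
    rw [conjToDual_apply, LinearIsometryEquiv.norm_map, hJ.norm_map hR hε]⟩
  rw [← L.inner_map_map y x, ← inner_toDual]
  rfl

lemma IsStructureMap.conj_coeff {R : UnitaryRep.{v, w} G} (hR : R.IsIrreducible) {ε : ℂ}
    (hε : ‖ε‖ = 1) {J : R.V →ₛₗ[starRingEnd ℂ] R.V} (hJ : R.IsStructureMap ε J) (x y : R.V)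
    (g : G) : conj (R.coeff x y g) = R.coeff (J x) (J y) g := by
  rw [coeff, coeff, ← hJ.1, hJ.inner_map hR hε, inner_conj_symm]

/-- An irreducible self-dual representation is of real or of quaternionic type: the isomorphism
with the dual gives an isometric conjugate-linear intertwiner, whose square is a scalar, real
because it commutes with `J`. -/
theorem IsIrreducible.isRealType_or_isQuaternionicType {R : UnitaryRep.{v, w} G}
    (hR : R.IsIrreducible) (h : R.IsSelfDual) : R.IsRealType ∨ R.IsQuaternionicType := by
  have := hR.nontrivial
  obtain ⟨z, hz⟩ := exists_ne (0 : R.V)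
  obtain ⟨T, hT⟩ := isDualOf_iff.mp h
  let J : R.V →ₛₗ[starRingEnd ℂ] R.V :=
    R.toDual.symm.toLinearEquiv.toLinearMap.comp T.toLinearEquiv.toLinearMap
  have hJT : ∀ x, J x = R.toDual.symm (T x) := fun _ => rfl
  have hJn : ∀ x, ‖J x‖ = ‖x‖ := fun x => by
    rw [hJT, LinearIsometryEquiv.norm_map, LinearIsometryEquiv.norm_map]
  have hJπ : ∀ g x, J (R.π g x) = R.π g (J x) := fun g x => by
    rw [hJT, hT, LinearIsometryEquiv.symm_apply_eq, ← dual_π_toDual, hJT,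
      LinearIsometryEquiv.apply_symm_apply]
  obtain ⟨c, hc⟩ := hR.exists_eq_smul (T := (J.comp J : R.V →ₗ[ℂ] R.V)) fun g x => by
    simp only [LinearMap.comp_apply, hJπ]
  have hc' : ∀ x, J (J x) = c • x := hc
  have hJz : J z ≠ 0 := by rwa [← norm_ne_zero_iff, hJn, norm_ne_zero_iff]
  -- `J` commutes with `J² = c`, so that `c` is real
  have hreal : conj c = c := by
    have h1 : J (J (J z)) = conj c • J z := by rw [hc' z, LinearMap.map_smulₛₗ]
    rw [hc'] at h1
    exact (smul_left_injective ℂ hJz h1).symm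
  have hnorm : ‖c‖ = 1 := by
    have h1 := (hJn (J z)).trans (hJn z)
    rw [hc', norm_smul] at h1
    exact mul_right_cancel₀ (norm_ne_zero_iff.mpr hz) (h1.trans (one_mul _).symm)
  obtain ⟨r, rfl⟩ := Complex.conj_eq_iff_real.mp hreal
  rw [Complex.norm_real, Real.norm_eq_abs] at hnorm
  rcases eq_or_eq_neg_of_abs_eq hnorm with rfl | rfl
  · exact .inl ⟨h, J, hJπ, fun x => by simpa using hc' x⟩
  · exact .inr ⟨h, J, hJπ, fun x => by simpa using hc' x⟩

end general

section finite
variable {G : Type v} [Group G] [Fintype G]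

/-- The average over `G` of the rank-one operators `y' ↦ ⟪π'(g) x', y'⟫ π(g) x`, without the
factor `1 / |G|`. It intertwines `π'` with `π`. -/
noncomputable def average (R : UnitaryRep.{v, w} G) (R' : UnitaryRep.{v, u} G) (x : R.V)
    (x' : R'.V) : R'.V →ₗ[ℂ] R.V :=
  ∑ g, ((innerSL ℂ (R'.π g x')).toLinearMap).smulRight (R.π g x)

lemma average_apply (R : UnitaryRep.{v, w} G) (R' : UnitaryRep.{v, u} G) (x : R.V)
    (x' y' : R'.V) : average R R' x x' y' = ∑ g, inner ℂ (R'.π g x') y' • R.π g x := by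
  simp [average, LinearMap.sum_apply]

lemma average_intertwines (R : UnitaryRep.{v, w} G) (R' : UnitaryRep.{v, u} G) (x : R.V)
    (x' y' : R'.V) (h : G) : average R R' x x' (R'.π h y') = R.π h (average R R' x x' y') := by
  rw [average_apply, average_apply, map_sum, ← Equiv.sum_comp (Equiv.mulLeft h)]
  refine Finset.sum_congr rfl fun g _ => ?_
  rw [Equiv.coe_mulLeft, π_mul_apply, π_mul_apply, LinearIsometryEquiv.inner_map_map, map_smul]

lemma sum_coeff_mul_conj_coeff (R : UnitaryRep.{v, w} G) (R' : UnitaryRep.{v, u} G) (x y : R.V)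
    (x' y' : R'.V) : ∑ g, R.coeff x y g * conj (R'.coeff x' y' g) =
      inner ℂ y (average R R' x x' y') := by
  rw [average_apply, inner_sum]
  refine Finset.sum_congr rfl fun g _ => ?_
  rw [coeff, coeff, inner_conj_symm, inner_smul_right, mul_comm]

theorem sum_coeff_mul_conj_coeff_of_not_equivalent {R : UnitaryRep.{v, w} G}
    {R' : UnitaryRep.{v, u} G} (hR : R.IsIrreducible) (hR' : R'.IsIrreducible)
    (h : ¬ R'.Equivalent R) (x y : R.V) (x' y' : R'.V) :
    ∑ g, R.coeff x y g * conj (R'.coeff x' y' g) = 0 := by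
  rw [sum_coeff_mul_conj_coeff]
  by_cases h0 : average R R' x x' = 0
  · simp [h0]
  · exact absurd (hR'.equivalent_of_ne_zero hR (fun g y => average_intertwines R R' x x' y g) h0) h

theorem sum_coeff_mul_conj_coeff_self {R : UnitaryRep.{v, w} G}
    (hR : R.IsIrreducible) (x y x' y' : R.V) :
    ∑ g, R.coeff x y g * conj (R.coeff x' y' g) =
      Fintype.card G / R.dim * (inner ℂ x' x * inner ℂ y y') := by
  have := hR.nontrivial
  rw [sum_coeff_mul_conj_coeff]
  obtain ⟨c, hc⟩ := hR.exists_eq_smul (fun g y => average_intertwines R R x x' y g)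
  have hd : (R.dim : ℂ) ≠ 0 := by
    exact_mod_cast (Module.finrank_pos (R := ℂ) (M := R.V)).ne'
  have hcd : c * R.dim = Fintype.card G * inner ℂ x' x := by
    let b := stdOrthonormalBasis ℂ R.V
    have h1 : ∑ i, inner ℂ (b i) (average R R x x' (b i)) = c * R.dim := by
      simp_rw [hc, inner_smul_right]
      simp [mul_comm]
    rw [← h1]
    simp_rw [average_apply, inner_sum, inner_smul_right]
    rw [Finset.sum_comm]
    simp_rw [b.sum_inner_mul_inner, LinearIsometryEquiv.inner_map_map]
    simp
  rw [hc, inner_smul_right, eq_div_of_mul_eq hd hcd]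
  ring

theorem sum_coeff_mul_coeff_of_not_isDualOf {R R' : UnitaryRep.{v, w} G} (hR : R.IsIrreducible)
    (hR' : R'.IsIrreducible) (h : ¬ R.IsDualOf R') (x y : R.V) (x' y' : R'.V) :
    ∑ g, R.coeff x y g * R'.coeff x' y' g = 0 := by
  have := sum_coeff_mul_conj_coeff_of_not_equivalent hR hR'.dual
    (fun h' => h (isDualOf_iff.mpr h'.symm)) x y (R'.toDual x') (R'.toDual y')
  simpa [coeff_dual] using this
end finite
end UnitaryRep

/-! ### Matrix coefficients span `ℓ²(G)` -/

namespace UnitaryRep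

section general
variable {G : Type v} [Group G]

lemma coeff_map_equiv {R : UnitaryRep.{v, w} G} {R' : UnitaryRep.{v, u} G}
    (T : R.V ≃ₗᵢ[ℂ] R'.V) (hT : ∀ g x, T (R.π g x) = R'.π g (T x)) (x y : R.V) (g : G) :
    R'.coeff (T x) (T y) g = R.coeff x y g := by
  rw [coeff, coeff, ← hT, LinearIsometryEquiv.inner_map_map]

/-- The restriction of a unitary representation to an invariant subspace. -/
noncomputable def restrict (R : UnitaryRep.{v, w} G) (U : Submodule ℂ R.V)
    (hU : ∀ g, ∀ x ∈ U, R.π g x ∈ U) : UnitaryRep.{v, w} G where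
  V := U
  π :=
    { toFun := fun g =>
        { toFun := fun x => ⟨R.π g x, hU g x x.2⟩
          invFun := fun x => ⟨R.π g⁻¹ x, hU g⁻¹ x x.2⟩
          map_add' := fun x y => Subtype.ext (map_add _ _ _)
          map_smul' := fun c x => Subtype.ext (map_smul _ _ _)
          left_inv := fun x => Subtype.ext <| by
            change R.π g⁻¹ (R.π g x) = x
            rw [← π_mul_apply, inv_mul_cancel, map_one]; rfl
          right_inv := fun x => Subtype.ext <| by
            change R.π g (R.π g⁻¹ x) = x
            rw [← π_mul_apply, mul_inv_cancel, map_one]; rfl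
          norm_map' := fun x => (R.π g).norm_map x }
      map_one' := LinearIsometryEquiv.ext fun x => Subtype.ext <| by
        change R.π 1 x = x
        rw [map_one]; rfl
      map_mul' := fun g h => LinearIsometryEquiv.ext fun x => Subtype.ext <|
        R.π_mul_apply g h x }

lemma exists_irreducible_restrict (R : UnitaryRep.{v, w} G) {U : Submodule ℂ R.V}
    (hU : ∀ g, ∀ x ∈ U, R.π g x ∈ U) (h0 : U ≠ ⊥) :
    ∃ (U' : Submodule ℂ R.V) (hU' : ∀ g, ∀ x ∈ U', R.π g x ∈ U'), U' ≤ U ∧ U' ≠ ⊥ ∧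
      (R.restrict U' hU').IsIrreducible := by
  obtain ⟨U', ⟨hle, hU', hne⟩, hmin⟩ := WellFounded.has_min
    (wellFounded_lt : WellFounded ((· < ·) : Submodule ℂ R.V → Submodule ℂ R.V → Prop))
    {U' | U' ≤ U ∧ (∀ g, ∀ x ∈ U', R.π g x ∈ U') ∧ U' ≠ ⊥} ⟨U, le_rfl, hU, h0⟩
  refine ⟨U', hU', hle, hne, (isIrreducible_iff _).mpr
    ⟨(Submodule.nontrivial_iff_ne_bot).mpr hne, fun (Q : Submodule ℂ U') hQ => ?_⟩⟩
  by_cases hQ0 : Q = ⊥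
  · exact .inl hQ0
  refine .inr ?_
  have hQle : Q.map U'.subtype ≤ U' := Submodule.map_subtype_le _ _
  have hnlt : ¬ Q.map U'.subtype < U' := hmin (Q.map U'.subtype) ⟨hQle.trans hle, fun g x hx => by
    obtain ⟨z, hz, rfl⟩ := hx
    exact ⟨_, hQ g z hz, rfl⟩, fun h => hQ0 <|
      Submodule.map_injective_of_injective U'.injective_subtype
        (h.trans (Submodule.map_bot _).symm)⟩
  have heq : Q.map U'.subtype = U' := hQle.eq_of_not_lt hnlt
  refine (Submodule.eq_top_iff').mpr fun (x : U') => ?_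
  obtain ⟨z, hz, hzx⟩ : (x : R.V) ∈ Q.map U'.subtype := by
    rw [heq]; exact x.2
  rwa [← Subtype.ext hzx]

end general

section finite
variable {G : Type u} [Group G] [Fintype G]

/-- The operator `f ↦ (h ↦ f (h g))` on `ℓ²(G)`. -/
noncomputable def rightTranslation (g : G) : EuclideanSpace ℂ G ≃ₗᵢ[ℂ] EuclideanSpace ℂ G :=
  LinearIsometryEquiv.piLpCongrLeft 2 ℂ ℂ (Equiv.mulRight g⁻¹)

lemma rightTranslation_apply (g : G) (f : EuclideanSpace ℂ G) (h : G) :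
    rightTranslation g f h = f (h * g) := by
  simp [rightTranslation]

variable (G) in
/-- The right regular representation of `G` on `ℓ²(G)`. -/
noncomputable def regular : UnitaryRep.{u, u} G where
  V := EuclideanSpace ℂ G
  π :=
    { toFun := rightTranslation
      map_one' := by
        refine LinearIsometryEquiv.ext fun f => ?_
        ext h
        rw [rightTranslation_apply, mul_one]; rfl
      map_mul' := fun g h => by
        refine LinearIsometryEquiv.ext fun f => ?_
        ext k
        change _ = rightTranslation g (rightTranslation h f) k
        rw [rightTranslation_apply, rightTranslation_apply, rightTranslation_apply, mul_assoc] }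

/-- Every nonzero right-invariant space of functions contains an irreducible right-invariant one,
and the matrix coefficients of the latter are coefficients of a member of `irr`. -/
lemma exists_invariant_subspace_coeff {ι : Type w} {irr : ι → UnitaryRep.{u, u} G}
    (hirr : IsUnitaryDual irr) {U : Submodule ℂ (EuclideanSpace ℂ G)}
    (hU : ∀ g, ∀ f ∈ U, rightTranslation g f ∈ U) (h0 : U ≠ ⊥) :
    ∃ U' ≤ U, U' ≠ ⊥ ∧ ∃ hU' : ∀ g, ∀ f ∈ U', rightTranslation g f ∈ U', ∃ i,
      ∀ f p : U', ∃ x y : (irr i).V, ∀ g,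
        inner ℂ p ⟨rightTranslation g f, hU' g f f.2⟩ = (irr i).coeff x y g := by
  obtain ⟨U', hU', hle, hne, hirred⟩ := (regular G).exists_irreducible_restrict hU h0
  obtain ⟨i, T, hT⟩ := hirr.complete _ hirred
  exact ⟨U', hle, hne, hU', i, fun f p => ⟨T f, T p, fun g => (coeff_map_equiv T hT f p g).symm⟩⟩

/-- The Peter–Weyl theorem for finite groups. If the orthogonal complement of the span of the
coefficients were nonzero, it would contain an irreducible right-invariant subspace `U`; but every
`f ∈ U` is a matrix coefficient of `U`, since `f g = ⟪δ₁, R_g f⟫` and `δ₁` may be projected onto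
`U`. -/
theorem span_coeff_eq_top {ι : Type w} {irr : ι → UnitaryRep.{u, u} G}
    (hirr : IsUnitaryDual irr) {W : Submodule ℂ (EuclideanSpace ℂ G)}
    (hW : ∀ i x y, WithLp.toLp 2 ((irr i).coeff x y) ∈ W) : W = ⊤ := by
  classical
  set W₀ := Submodule.span ℂ {φ : EuclideanSpace ℂ G |
      ∃ i x y, φ = WithLp.toLp 2 ((irr i).coeff x y)} with hW₀
  suffices W₀ = ⊤ by
    rw [eq_top_iff, ← this, hW₀, Submodule.span_le]
    rintro _ ⟨i, x, y, rfl⟩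
    exact hW i x y
  rw [← Submodule.orthogonal_eq_bot_iff]
  by_contra hne
  have htrans : ∀ g, W₀ ≤ W₀.comap (rightTranslation g).toLinearEquiv.toLinearMap := by
    intro g
    conv_lhs => rw [hW₀]
    rw [Submodule.span_le]
    rintro _ ⟨i, x, y, rfl⟩
    refine Submodule.subset_span ⟨i, (irr i).π g x, y, ?_⟩
    ext h
    exact (rightTranslation_apply _ _ _).trans
      (congrArg (inner ℂ y) ((irr i).π_mul_apply h g x))
  have hinv : ∀ g, ∀ f ∈ W₀ᗮ, rightTranslation g f ∈ W₀ᗮ := by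
    intro g f hf
    rw [Submodule.mem_orthogonal] at hf ⊢
    intro φ hφ
    have h3 := (regular G).inner_π_left g⁻¹ φ f
    rw [inv_inv] at h3
    exact h3.symm.trans (hf _ (htrans g⁻¹ hφ))
  obtain ⟨U, hle, hU0, hU, i, hcoeff⟩ := exists_invariant_subspace_coeff hirr hinv hne
  obtain ⟨f, hf, hf0⟩ := U.exists_mem_ne_zero_of_ne_bot hU0
  obtain ⟨x, y, hxy⟩ := hcoeff ⟨f, hf⟩ (U.orthogonalProjectionOnto (EuclideanSpace.single 1 1))
  have hmem : f ∈ W₀ := by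
    refine Submodule.subset_span ⟨i, x, y, ?_⟩
    ext g
    change f g = (irr i).coeff x y g
    rw [← hxy, Submodule.inner_orthogonalProjectionOnto_eq_of_mem_right,
      EuclideanSpace.inner_single_left]
    simp [rightTranslation_apply]
  exact hf0 (inner_self_eq_zero.mp (Submodule.mem_orthogonal _ _ |>.mp (hle hf) f hmem))
end finite
end UnitaryRep

/-! ### Orthogonality of real parts of matrix coefficients -/

namespace UnitaryRep
open scoped ComplexConjugate

section gen
variable {G : Type v} [Group G]

lemma coeff_add_left (R : UnitaryRep.{v, w} G) (x x' y : R.V) (g : G) :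
    R.coeff (x + x') y g = R.coeff x y g + R.coeff x' y g := by
  simp [coeff]

lemma coeff_smul_left (R : UnitaryRep.{v, w} G) (c : ℂ) (x y : R.V) (g : G) :
    R.coeff (c • x) y g = c * R.coeff x y g := by
  simp [coeff]

lemma coeff_add_right (R : UnitaryRep.{v, w} G) (x y y' : R.V) (g : G) :
    R.coeff x (y + y') g = R.coeff x y g + R.coeff x y' g := by
  simp [coeff]

lemma coeff_smul_right (R : UnitaryRep.{v, w} G) (c : ℂ) (x y : R.V) (g : G) :
    R.coeff x (c • y) g = conj c * R.coeff x y g := by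
  simp [coeff, mul_comm]

/-- If `J² = 1` and `J'² = -1`, then `J' = a J` for a scalar `a` by Schur's lemma, and so
`J'² = |a|²`, which is not `-1`. -/
lemma IsRealType.not_isQuaternionicType {R : UnitaryRep.{v, w} G} (hR : R.IsIrreducible)
    (h : R.IsRealType) : ¬ R.IsQuaternionicType := by
  rintro ⟨-, J', hJ', hJ'2⟩
  obtain ⟨-, J, hJ, hJ2⟩ := h
  have := hR.nontrivial
  obtain ⟨z, hz⟩ := exists_ne (0 : R.V)
  obtain ⟨c, hc⟩ := hR.exists_eq_smul (T := (J.comp J' : R.V →ₗ[ℂ] R.V)) fun g x => by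
    simp only [LinearMap.comp_apply, hJ', hJ]
  have hc' : ∀ x, J (J' x) = c • x := hc
  have h1 : ∀ x, J' x = conj c • J x := fun x => by
    have h2 := hJ2 (J' x)
    rwa [hc', LinearMap.map_smulₛₗ, one_smul, eq_comm] at h2
  have h2 := hJ'2 z
  rw [h1 (J' z), hc', smul_smul] at h2
  have h3 : conj c * c = -1 := smul_left_injective ℂ hz h2
  rw [mul_comm, Complex.mul_conj] at h3
  have h4 := congrArg Complex.re h3
  simp only [Complex.ofReal_re, Complex.neg_re, Complex.one_re] at h4
  linarith [Complex.normSq_nonneg c]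

lemma IsStructureMap.inner_eq_ofReal_re_of_fixed {R : UnitaryRep.{v, w} G} (hR : R.IsIrreducible)
    {J : R.V →ₛₗ[starRingEnd ℂ] R.V} (hJ : R.IsStructureMap 1 J) {x y : R.V}
    (hx : J x = x) (hy : J y = y) : inner ℂ x y = ((inner ℂ x y : ℂ).re : ℂ) := by
  have h1 := hJ.inner_map hR (by simp) x y
  rw [hx, hy] at h1
  exact (Complex.conj_eq_iff_re.mp (by rw [inner_conj_symm, h1])).symm

/-- An orthonormal basis of the real form is an orthonormal basis of the complex space. -/
lemma IsStructureMap.exists_orthonormalBasis {R : UnitaryRep.{v, w} G} (hR : R.IsIrreducible)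
    {J : R.V →ₛₗ[starRingEnd ℂ] R.V} (hJ : R.IsStructureMap 1 J)
    (b : OrthonormalBasis (Fin R.dim) ℝ (R.realForm J)) :
    ∃ b' : OrthonormalBasis (Fin R.dim) ℂ R.V, ∀ k, b' k = b k := by
  have ho : Orthonormal ℂ (fun k => (b k : R.V)) := by
    rw [orthonormal_iff_ite]
    intro k l
    have h1 := orthonormal_iff_ite.mp b.orthonormal k l
    rw [hJ.inner_eq_ofReal_re_of_fixed hR (b k).2 (b l).2]
    have h2 : (inner ℂ (b k : R.V) (b l : R.V)).re = inner ℝ (b k) (b l) := rfl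
    rw [h2, h1]
    split_ifs <;> simp
  have hR' := hR.nontrivial
  have : Nonempty (Fin R.dim) := ⟨⟨0, Module.finrank_pos⟩⟩
  refine ⟨OrthonormalBasis.mk ho ?_, fun k => by rw [OrthonormalBasis.coe_mk]⟩
  rw [ho.linearIndependent.span_eq_top_of_card_eq_finrank (Fintype.card_fin _)]

lemma IsEigenvector.smul {R : UnitaryRep.{v, w} G} {S : Finset G} {x : R.V}
    (h : R.IsEigenvector S x) (a : ℂ) : R.IsEigenvector S (a • x) := by
  obtain ⟨c, hc⟩ := h
  refine ⟨c, ?_⟩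
  simp_rw [map_smul]
  rw [← Finset.smul_sum, hc, smul_comm]

/-- For symmetric `S` the operator `π(A)` is self-adjoint, so that its eigenvalues are real. -/
lemma IsEigenvector.exists_real {R : UnitaryRep.{v, w} G} {S : Finset G}
    (hS : ∀ s ∈ S, s⁻¹ ∈ S) {x : R.V} (h : R.IsEigenvector S x) :
    ∃ c : ℝ, ∑ s ∈ S, R.π s x = (c : ℂ) • x := by
  obtain ⟨c, hc⟩ := h
  rcases eq_or_ne x 0 with rfl | hx
  · exact ⟨0, by simp⟩
  have h1 : inner ℂ x (∑ s ∈ S, R.π s x) = inner ℂ (∑ s ∈ S, R.π s x) x := by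
    rw [inner_sum, sum_inner]
    refine Finset.sum_nbij' (·⁻¹) (·⁻¹) hS hS (by simp) (by simp) fun s _ => ?_
    rw [inner_π_left, inv_inv]
  rw [hc, inner_smul_left, inner_smul_right] at h1
  have h2 := mul_right_cancel₀ (inner_self_ne_zero.mpr hx) h1
  obtain ⟨r, rfl⟩ := Complex.conj_eq_iff_real.mp h2.symm
  exact ⟨r, hc⟩

end gen

section fin
variable {G : Type v} [Group G] [Fintype G]

omit [Group G] in
lemma sum_re_mul_re (c c' : G → ℂ) : ∑ g, (c g).re * (c' g).re =
    ((∑ g, c g * c' g) + ∑ g, c g * conj (c' g)).re / 2 := by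
  rw [← Finset.sum_add_distrib, Complex.re_sum, Finset.sum_div]
  refine Finset.sum_congr rfl fun g _ => ?_
  simp [Complex.mul_re]

lemma sum_coeff_mul_coeff_of_isStructureMap {R : UnitaryRep.{v, w} G} (hR : R.IsIrreducible)
    {ε : ℂ} (hε : ‖ε‖ = 1) {J : R.V →ₛₗ[starRingEnd ℂ] R.V} (hJ : R.IsStructureMap ε J)
    (x y x' y' : R.V) : ∑ g, R.coeff x y g * R.coeff x' y' g =
      Fintype.card G / R.dim * (inner ℂ (J x') x * inner ℂ y (J y')) := by
  rw [← sum_coeff_mul_conj_coeff_self hR]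
  refine Finset.sum_congr rfl fun g _ => ?_
  rw [← hJ.conj_coeff hR hε, Complex.conj_conj]

lemma sum_coeff_mul_coeff_of_isSelfDual {R R' : UnitaryRep.{v, w} G} (hR : R.IsIrreducible)
    (hR' : R'.IsIrreducible) (hne : ¬ R'.Equivalent R) (h : R'.IsSelfDual) (x y : R.V)
    (x' y' : R'.V) : ∑ g, R.coeff x y g * R'.coeff x' y' g = 0 := by
  obtain ⟨ε, hε, J, hJ⟩ : ∃ ε : ℂ, ‖ε‖ = 1 ∧ ∃ J, R'.IsStructureMap ε J := by
    rcases hR'.isRealType_or_isQuaternionicType h with ⟨-, J, hJ⟩ | ⟨-, J, hJ⟩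
    · exact ⟨1, by simp, J, hJ⟩
    · exact ⟨-1, by simp, J, hJ⟩
  rw [← sum_coeff_mul_conj_coeff_of_not_equivalent hR hR' hne x y (J x') (J y')]
  refine Finset.sum_congr rfl fun g _ => ?_
  rw [← hJ.conj_coeff hR' hε, Complex.conj_conj]

/-- For a representation that is not self-dual, coefficients are orthogonal to their complex
conjugates, so that the real part carries half of the norm. -/
lemma sum_re_coeff_of_not_isSelfDual {R : UnitaryRep.{v, w} G} (hR : R.IsIrreducible)
    (h : ¬ R.IsSelfDual) (x y x' y' : R.V) :
    ∑ g, (R.coeff x y g).re * (R.coeff x' y' g).re =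
      Fintype.card G / (2 * R.dim) * (inner ℂ x' x * inner ℂ y y' : ℂ).re := by
  rw [sum_re_mul_re, sum_coeff_mul_coeff_of_not_isDualOf hR hR h,
    sum_coeff_mul_conj_coeff_self hR, zero_add, ← Complex.ofReal_natCast, ← Complex.ofReal_natCast,
    ← Complex.ofReal_div, Complex.re_ofReal_mul]
  ring

/-- With a structure map `J` the conjugate of a coefficient is again a coefficient, that of the
images under `J`; the product without conjugation vanishes when `J x'` is orthogonal to `x`. -/
lemma sum_re_coeff_of_inner_structureMap_eq_zero {R : UnitaryRep.{v, w} G} (hR : R.IsIrreducible)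
    {ε : ℂ} (hε : ‖ε‖ = 1) {J : R.V →ₛₗ[starRingEnd ℂ] R.V} (hJ : R.IsStructureMap ε J)
    {x x' : R.V} (hx : inner ℂ (J x') x = 0) (y y' : R.V) :
    ∑ g, (R.coeff x y g).re * (R.coeff x' y' g).re =
      Fintype.card G / (2 * R.dim) * (inner ℂ x' x * inner ℂ y y' : ℂ).re := by
  rw [sum_re_mul_re, sum_coeff_mul_coeff_of_isStructureMap hR hε hJ, hx,
    sum_coeff_mul_conj_coeff_self hR, zero_mul, mul_zero, zero_add, ← Complex.ofReal_natCast,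
    ← Complex.ofReal_natCast, ← Complex.ofReal_div, Complex.re_ofReal_mul]
  ring

lemma sum_re_coeff_of_real {R : UnitaryRep.{v, w} G} (hR : R.IsIrreducible)
    {J : R.V →ₛₗ[starRingEnd ℂ] R.V} (hJ : R.IsStructureMap 1 J)
    (x y : R.V) {x' y' : R.V} (hx' : J x' = x') (hy' : J y' = y') :
    ∑ g, (R.coeff x y g).re * (R.coeff x' y' g).re =
      Fintype.card G / R.dim * (inner ℂ x' x * inner ℂ y y' : ℂ).re := by
  rw [sum_re_mul_re, sum_coeff_mul_coeff_of_isStructureMap hR (by simp) hJ, hx', hy',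
    sum_coeff_mul_conj_coeff_self hR, ← Complex.ofReal_natCast, ← Complex.ofReal_natCast,
    ← Complex.ofReal_div, Complex.add_re, Complex.re_ofReal_mul]
  ring
end fin
end UnitaryRep

/-! ### Orthonormality of the random basis -/

namespace BasisChoices
open scoped ComplexConjugate

variable {G : Type u} [Group G] {ι : Type w} {irr : ι → UnitaryRep.{u, u} G} {S : Finset G}

/-- The scalar `a` with `Re (a z) = Re z` (for `false`) or `Re (a z) = Im z` (for `true`). -/
noncomputable def phase : Bool → ℂ
  | false => 1
  | true => -Complex.I

lemma re_conj_phase_mul (s s' : Bool) :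
    (conj (phase s') * phase s).re = if s = s' then 1 else 0 := by
  cases s <;> cases s' <;> simp [phase]

lemma norm_phase (s : Bool) : ‖phase s‖ = 1 := by cases s <;> simp [phase]

/-- The representation from which a basis function is built. -/
def rep (D : BasisChoices irr S) : D.Index → ι
  | .inl ⟨i, _⟩ => i
  | .inr (.inl ⟨i, _⟩) => i
  | .inr (.inr ⟨i, _⟩) => i

/-- The vector `v` such that the basis function is a multiple of `Re ⟨π(g) v, w⟩`. Imaginary parts
are written as real parts by multiplying the eigenvector by `-i`. -/
noncomputable def left (D : BasisChoices irr S) : ∀ b : D.Index, (irr (D.rep b)).V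
  | .inl ⟨i, k, _, s⟩ => phase s • D.vC i k
  | .inr (.inl ⟨i, k, _, s⟩) => phase s • D.vQ i (Sum.inl k)
  | .inr (.inr ⟨i, k, _⟩) => (D.vR i k : (irr i).V)

/-- The random vector `w` such that the basis function is a multiple of `Re ⟨π(g) v, w⟩`. -/
noncomputable def right (D : BasisChoices irr S) (x : D.X) : ∀ b : D.Index, (irr (D.rep b)).V
  | .inl ⟨i, _, j, _⟩ => (x.1 i).1 (D.eC i j)
  | .inr (.inl ⟨i, _, j, _⟩) => (x.2.1 i).1 (D.eQ i j)
  | .inr (.inr ⟨i, _, j⟩) => ((x.2.2 i).1 (D.eR i j) : (irr i).V)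

/-- The square of the normalising constant times `|G|`: `2 dim V`, or `dim V` in the real case. It
is the real dimension of the space (`V` or `V_J`) in which `w` varies. -/
noncomputable def scale (D : BasisChoices irr S) : D.Index → ℝ
  | .inl ⟨i, _⟩ => 2 * (irr i).dim
  | .inr (.inl ⟨i, _⟩) => 2 * (irr i).dim
  | .inr (.inr ⟨i, _⟩) => (irr i).dim

lemma phase_mul_re (z : ℂ) : (phase false * z).re = z.re ∧ (phase true * z).re = z.im := by
  simp [phase]

/-- All three kinds of basis functions have the same form. In the real case the coefficient is
already real, as both vectors are fixed by `J`. -/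
lemma basis_apply [Fintype G] (hirr : IsUnitaryDual irr) (D : BasisChoices irr S) (x : D.X)
    (b : D.Index) (g : G) : D.basis x b g = ((√(D.scale b) / √(Fintype.card G) *
      ((irr (D.rep b)).coeff (D.left b) (D.right x b) g).re : ℝ) : ℂ) := by
  rcases b with ⟨i, k, j, s⟩ | ⟨i, k, j, s⟩ | ⟨i, k, j⟩
  · cases s <;>
      simp only [rep, left, right, scale, UnitaryRep.coeff_smul_left, phase_mul_re] <;> rfl
  · cases s <;>
      simp only [rep, left, right, scale, UnitaryRep.coeff_smul_left, phase_mul_re] <;> rfl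
  · change ((√(irr i).dim / √(Fintype.card G) : ℝ) : ℂ) *
        (irr i).coeff (D.vR i k : (irr i).V) ((x.2.2 i).1 (D.eR i j) : (irr i).V) g = _
    rw [Complex.ofReal_mul]
    congr 1
    refine (D.JR_spec i).inner_eq_ofReal_re_of_fixed (hirr.irreducible i)
      ((x.2.2 i).1 (D.eR i j)).2 ?_
    rw [(D.JR_spec i).1]
    congr 1
    exact (D.vR i k).2

lemma rep_mem_or_isSelfDual (D : BasisChoices irr S) (b : D.Index) :
    D.rep b ∈ D.C ∨ (irr (D.rep b)).IsSelfDual := by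
  rcases b with ⟨i, k, j, s⟩ | ⟨i, k, j, s⟩ | ⟨i, k, j⟩
  · exact .inl i.2
  · exact .inr i.2.1
  · exact .inr i.2.1

/-- This includes `i = j`, where `pair` gives the absurd `Xor p p`. -/
lemma not_isDualOf_of_mem (D : BasisChoices irr S) {i j : ι} (hi : i ∈ D.C) (hj : j ∈ D.C) :
    ¬ (irr j).IsDualOf (irr i) := fun h => by
  rcases D.pair i j (D.not_selfDual i hi) h with h | h
  · exact h.2 hj
  · exact h.2 hi

section fin
variable [Fintype G]

lemma sum_re_coeff_of_ne (hirr : IsUnitaryDual irr) (D : BasisChoices irr S) {i j : ι}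
    (hij : i ≠ j) (hi : i ∈ D.C ∨ (irr i).IsSelfDual) (hj : j ∈ D.C ∨ (irr j).IsSelfDual)
    (x y : (irr i).V) (x' y' : (irr j).V) :
    ∑ g, ((irr i).coeff x y g).re * ((irr j).coeff x' y' g).re = 0 := by
  have hne : ¬ (irr j).Equivalent (irr i) := fun h => hij (hirr.injective _ _ h).symm
  have hne' : ¬ (irr i).Equivalent (irr j) := fun h => hij (hirr.injective _ _ h)
  have hA : ∑ g, (irr i).coeff x y g * (irr j).coeff x' y' g = 0 := by
    rcases hj with hj | hj
    · rcases hi with hi | hi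
      · exact UnitaryRep.sum_coeff_mul_coeff_of_not_isDualOf (hirr.irreducible i)
          (hirr.irreducible j) (D.not_isDualOf_of_mem hj hi) _ _ _ _
      · simp_rw [mul_comm ((irr i).coeff _ _ _)]
        exact UnitaryRep.sum_coeff_mul_coeff_of_isSelfDual (hirr.irreducible j)
          (hirr.irreducible i) hne' hi _ _ _ _
    · exact UnitaryRep.sum_coeff_mul_coeff_of_isSelfDual (hirr.irreducible i)
        (hirr.irreducible j) hne hj _ _ _ _
  rw [UnitaryRep.sum_re_mul_re, hA, UnitaryRep.sum_coeff_mul_conj_coeff_of_not_equivalent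
    (hirr.irreducible i) (hirr.irreducible j) hne]
  simp

omit [Fintype G] in
/-- The vectors `v k` and `J v k'` of a quaternionic eigenbasis are orthogonal. -/
lemma inner_JQ_vQ (D : BasisChoices irr S) (i : {i // (irr i).IsQuaternionicType})
    (k k' : Fin ((irr i).dim / 2)) (a a' : ℂ) :
    inner ℂ (D.JQ i (a' • D.vQ i (Sum.inl k'))) (a • D.vQ i (Sum.inl k)) = 0 := by
  rw [LinearMap.map_smulₛₗ, ← D.vQ_J, inner_smul_left, inner_smul_right,
    (D.vQ i).inner_eq_zero (by simp), mul_zero, mul_zero]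

lemma inner_isometry_basis {𝕜 E κ : Type*} [RCLike 𝕜] [NormedAddCommGroup E]
    [InnerProductSpace 𝕜 E] [CompleteSpace E] [Fintype κ] [DecidableEq κ] (u : IsometryGroup 𝕜 E)
    (e : OrthonormalBasis κ 𝕜 E) (j j' : κ) :
    inner 𝕜 (u.1 (e j)) (u.1 (e j')) = if j = j' then 1 else 0 := by
  rw [ContinuousLinearMap.inner_map_map_of_mem_unitary u.2, orthonormal_iff_ite.mp e.orthonormal]

omit [Fintype G] in
lemma inner_realForm_isometry {R : UnitaryRep.{u, u} G} (hR : R.IsIrreducible)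
    {J : R.V →ₛₗ[starRingEnd ℂ] R.V} (hJ : R.IsStructureMap 1 J) {κ : Type*} [Fintype κ]
    [DecidableEq κ] (o : IsometryGroup ℝ (R.realForm J)) (e : OrthonormalBasis κ ℝ (R.realForm J))
    (j j' : κ) : inner ℂ ((o.1 (e j) : R.realForm J) : R.V) ((o.1 (e j') : R.realForm J) : R.V) =
      if j = j' then 1 else 0 := by
  rw [hJ.inner_eq_ofReal_re_of_fixed hR (o.1 (e j)).2 (o.1 (e j')).2]
  have h := inner_isometry_basis o e j j'
  have h2 : (inner ℂ ((o.1 (e j) : R.realForm J) : R.V) ((o.1 (e j') : R.realForm J) : R.V)).re =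
    inner ℝ (o.1 (e j)) (o.1 (e j')) := rfl
  rw [h2, h]
  split_ifs <;> simp

lemma phase_delta {κ κ' : Type*} [DecidableEq κ] [DecidableEq κ'] (k k' : κ) (j j' : κ')
    (s s' : Bool) : (conj (phase s') * (phase s * if k' = k then 1 else 0) *
      (if j = j' then 1 else 0)).re = if k = k' ∧ j = j' ∧ s = s' then 1 else 0 := by
  by_cases hk : k = k'
  · by_cases hj : j = j'
    · subst hk hj
      simpa only [if_true, mul_one, true_and] using re_conj_phase_mul s s'
    · simp [hj]
  · simp [hk, Ne.symm hk]

lemma sqrt_div_mul_self {a N : ℝ} (ha : 0 < a) (hN : 0 < N) (z : ℝ) :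
    √a / √N * (√a / √N) * (N / a * z) = z := by
  rw [div_mul_div_comm, Real.mul_self_sqrt ha.le, Real.mul_self_sqrt hN.le]
  field_simp

lemma sum_re_coeff_nonSelfDual (hirr : IsUnitaryDual irr) (D : BasisChoices irr S) (i : D.C)
    (k k' : Fin (irr i).dim) (s s' : Bool) (y y' : (irr i).V) :
    ∑ g, ((irr i).coeff (phase s • D.vC i k) y g).re *
      ((irr i).coeff (phase s' • D.vC i k') y' g).re = Fintype.card G / (2 * (irr i).dim) *
        (conj (phase s') * (phase s * if k' = k then 1 else 0) * inner ℂ y y').re := by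
  rw [UnitaryRep.sum_re_coeff_of_not_isSelfDual (hirr.irreducible i) (D.not_selfDual i i.2),
    inner_smul_left, inner_smul_right, orthonormal_iff_ite.mp (D.vC i).orthonormal]

lemma sum_re_coeff_quaternionic (hirr : IsUnitaryDual irr) (D : BasisChoices irr S)
    (i : {i // (irr i).IsQuaternionicType}) (k k' : Fin ((irr i).dim / 2)) (s s' : Bool)
    (y y' : (irr i).V) :
    ∑ g, ((irr i).coeff (phase s • D.vQ i (Sum.inl k)) y g).re *
      ((irr i).coeff (phase s' • D.vQ i (Sum.inl k')) y' g).re =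
        Fintype.card G / (2 * (irr i).dim) *
          (conj (phase s') * (phase s * if k' = k then 1 else 0) * inner ℂ y y').re := by
  rw [UnitaryRep.sum_re_coeff_of_inner_structureMap_eq_zero (hirr.irreducible i) (by simp)
    (D.JQ_spec i) (D.inner_JQ_vQ i k k' _ _), inner_smul_left, inner_smul_right,
    orthonormal_iff_ite.mp (D.vQ i).orthonormal]
  simp only [Sum.inl.injEq]

lemma sum_re_coeff_real (hirr : IsUnitaryDual irr) (D : BasisChoices irr S)
    (i : {i // (irr i).IsRealType}) (k k' : Fin (irr i).dim) (y y' : (irr i).realForm (D.JR i)) :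
    ∑ g, ((irr i).coeff (D.vR i k : (irr i).V) (y : (irr i).V) g).re *
      ((irr i).coeff (D.vR i k' : (irr i).V) (y' : (irr i).V) g).re =
        Fintype.card G / (irr i).dim *
          ((if k' = k then 1 else 0) * inner ℂ (y : (irr i).V) (y' : (irr i).V)).re := by
  rw [UnitaryRep.sum_re_coeff_of_real (hirr.irreducible i) (D.JR_spec i) _ _ (D.vR i k').2 y'.2]
  have h := inner_realForm_isometry (hirr.irreducible i) (D.JR_spec i) 1 (D.vR i) k' k
  simp only [OneMemClass.coe_one, one_apply_eq_self] at h
  rw [h]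

omit [Fintype G] in
lemma dim_pos (hirr : IsUnitaryDual irr) (i : ι) : (0 : ℝ) < (irr i).dim := by
  have := (hirr.irreducible i).nontrivial
  exact_mod_cast (Module.finrank_pos (R := ℂ) (M := (irr i).V))

omit [Fintype G] in
lemma scale_pos (hirr : IsUnitaryDual irr) (D : BasisChoices irr S) (b : D.Index) :
    0 < D.scale b := by
  rcases b with ⟨i, _⟩ | ⟨i, _⟩ | ⟨i, _⟩ <;> have := dim_pos hirr i <;> simp only [scale] <;>
    positivity

open scoped Classical in
lemma sum_basis_mul_basis (hirr : IsUnitaryDual irr) (D : BasisChoices irr S) (x : D.X)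
    (b b' : D.Index) : ∑ g, (√(D.scale b) / √(Fintype.card G) *
        ((irr (D.rep b)).coeff (D.left b) (D.right x b) g).re) *
      (√(D.scale b') / √(Fintype.card G) *
        ((irr (D.rep b')).coeff (D.left b') (D.right x b') g).re) = if b = b' then 1 else 0 := by
  have hN : (0 : ℝ) < Fintype.card G := by exact_mod_cast Fintype.card_pos
  have hmul : ∀ p q r s : ℝ, p * q * (r * s) = p * r * (q * s) := fun p q r s => by ring
  simp_rw [hmul]
  rw [← Finset.mul_sum]
  by_cases hrep : D.rep b = D.rep b'
  swap
  · rw [sum_re_coeff_of_ne hirr D hrep (D.rep_mem_or_isSelfDual b) (D.rep_mem_or_isSelfDual b'),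
      mul_zero, if_neg (fun h => hrep (congrArg D.rep h))]
  -- The three kinds of index belong to disjoint sets of representations.
  have hQC : ∀ (i : D.C) (i' : {i // (irr i).IsQuaternionicType}), i.1 ≠ i'.1 := fun i i' h =>
    D.not_selfDual i i.2 (h ▸ i'.2.1)
  have hRC : ∀ (i : D.C) (i' : {i // (irr i).IsRealType}), i.1 ≠ i'.1 := fun i i' h =>
    D.not_selfDual i i.2 (h ▸ i'.2.1)
  have hQR : ∀ (i : {i // (irr i).IsRealType}) (i' : {i // (irr i).IsQuaternionicType}),
      i.1 ≠ i'.1 := fun i i' h =>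
    i.2.not_isQuaternionicType (hirr.irreducible i) (h ▸ i'.2)
  rcases b with ⟨i, k, j, s⟩ | ⟨i, k, j, s⟩ | ⟨i, k, j⟩ <;>
    rcases b' with ⟨i', k', j', s'⟩ | ⟨i', k', j', s'⟩ | ⟨i', k', j'⟩
  · obtain rfl : i = i' := Subtype.ext hrep
    have h := D.sum_re_coeff_nonSelfDual hirr i k k' s s' ((x.1 i).1 (D.eC i j))
      ((x.1 i).1 (D.eC i j'))
    rw [inner_isometry_basis, phase_delta] at h
    refine (congrArg _ h).trans ?_
    exact (sqrt_div_mul_self (D.scale_pos hirr (.inl ⟨i, k, j, s⟩)) hN _).trans (by simp)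
  · exact absurd hrep (hQC i i')
  · exact absurd hrep (hRC i i')
  · exact absurd hrep.symm (hQC i' i)
  · obtain rfl : i = i' := Subtype.ext hrep
    have h := D.sum_re_coeff_quaternionic hirr i k k' s s' ((x.2.1 i).1 (D.eQ i j))
      ((x.2.1 i).1 (D.eQ i j'))
    rw [inner_isometry_basis, phase_delta] at h
    refine (congrArg _ h).trans ?_
    exact (sqrt_div_mul_self (D.scale_pos hirr (.inr (.inl ⟨i, k, j, s⟩))) hN _).trans (by simp)
  · exact absurd hrep.symm (hQR i' i)
  · exact absurd hrep.symm (hRC i' i)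
  · exact absurd hrep (hQR i i')
  · obtain rfl : i = i' := Subtype.ext hrep
    refine (congrArg _ (D.sum_re_coeff_real hirr i k k' _ _)).trans ?_
    rw [inner_realForm_isometry (hirr.irreducible i) (D.JR_spec i)]
    refine (sqrt_div_mul_self (D.scale_pos hirr (.inr (.inr ⟨i, k, j⟩))) hN _).trans ?_
    by_cases hk : k = k'
    · subst hk
      by_cases hj : j = j' <;> simp [hj]
    · simp [hk, Ne.symm hk]

lemma orthonormal_basis (hirr : IsUnitaryDual irr) (D : BasisChoices irr S) (x : D.X) :
    Orthonormal ℂ (D.basis x) := by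
  classical
  rw [orthonormal_iff_ite]
  intro b b'
  rw [PiLp.inner_apply]
  simp_rw [basis_apply hirr]
  have h := congrArg (fun r : ℝ => (r : ℂ)) (D.sum_basis_mul_basis hirr x b b')
  simp only [Complex.ofReal_sum] at h
  refine Eq.trans (Finset.sum_congr rfl fun g _ => ?_) (h.trans (by split_ifs <;> simp))
  simp only [RCLike.inner_apply, Complex.conj_ofReal]
  rw [← Complex.ofReal_mul, mul_comm]

omit [Fintype G] in
lemma isEigenvector_left (D : BasisChoices irr S) (b : D.Index) :
    (irr (D.rep b)).IsEigenvector S (D.left b) := by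
  rcases b with ⟨i, k, j, s⟩ | ⟨i, k, j, s⟩ | ⟨i, k, j⟩
  · exact (D.vC_eigen i k).smul _
  · exact (D.vQ_eigen i _).smul _
  · exact D.vR_eigen i k

lemma exists_cayleyAdjacency_basis_eq (hirr : IsUnitaryDual irr) (hS : ∀ s ∈ S, s⁻¹ ∈ S)
    (D : BasisChoices irr S) (x : D.X) (b : D.Index) :
    ∃ c : ℝ, cayleyAdjacency S (D.basis x b) = (c : ℂ) • D.basis x b := by
  obtain ⟨c, hc⟩ := (D.isEigenvector_left b).exists_real hS
  refine ⟨c, ?_⟩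
  ext g
  simp only [cayleyAdjacency, PiLp.smul_apply, smul_eq_mul, basis_apply hirr]
  rw [← Complex.ofReal_sum, ← Complex.ofReal_mul, ← Finset.mul_sum, ← Complex.re_sum]
  have h : ∑ s ∈ S, (irr (D.rep b)).coeff (D.left b) (D.right x b) (g * s) =
      c * (irr (D.rep b)).coeff (D.left b) (D.right x b) g := by
    simp only [UnitaryRep.coeff, UnitaryRep.π_mul_apply]
    rw [← inner_sum, ← map_sum, hc, map_smul, inner_smul_right]
  rw [h, Complex.re_ofReal_mul]
  congr 1
  ring

end fin
end BasisChoices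

/-! ### The random basis spans `ℓ²(G)` -/

namespace UnitaryRep
open scoped ComplexConjugate
section
variable {G : Type v} [Group G] [Fintype G]

omit [Fintype G] in
lemma coeff_mem_of_left {R : UnitaryRep.{v, w} G} {W : Submodule ℂ (EuclideanSpace ℂ G)}
    {A : Set R.V} (hA : Submodule.span ℂ A = ⊤) {y : R.V}
    (h : ∀ x ∈ A, WithLp.toLp 2 (R.coeff x y) ∈ W) (x : R.V) :
    WithLp.toLp 2 (R.coeff x y) ∈ W := by
  have hx : x ∈ Submodule.span ℂ A := hA ▸ Submodule.mem_top
  induction hx using Submodule.span_induction with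
  | mem x hx => exact h x hx
  | zero => convert W.zero_mem using 1; ext g; simp [coeff]
  | add a b _ _ ha hb => convert W.add_mem ha hb using 1; ext g; simp [coeff_add_left]
  | smul c a _ ha => convert W.smul_mem c ha using 1; ext g; simp [coeff_smul_left]

omit [Fintype G] in
lemma coeff_mem_of_right {R : UnitaryRep.{v, w} G} {W : Submodule ℂ (EuclideanSpace ℂ G)}
    {A : Set R.V} (hA : Submodule.span ℂ A = ⊤) {x : R.V}
    (h : ∀ y ∈ A, WithLp.toLp 2 (R.coeff x y) ∈ W) (y : R.V) :
    WithLp.toLp 2 (R.coeff x y) ∈ W := by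
  have hy : y ∈ Submodule.span ℂ A := hA ▸ Submodule.mem_top
  induction hy using Submodule.span_induction with
  | mem y hy => exact h y hy
  | zero => convert W.zero_mem using 1; ext g; simp [coeff]
  | add a b _ _ ha hb => convert W.add_mem ha hb using 1; ext g; simp [coeff_add_right]
  | smul c a _ ha => convert W.smul_mem (conj c) ha using 1; ext g; simp [coeff_smul_right]

end
end UnitaryRep

namespace BasisChoices
open scoped ComplexConjugate

variable {G : Type u} [Group G] {ι : Type w} {irr : ι → UnitaryRep.{u, u} G} {S : Finset G}
variable [Fintype G]

lemma conj_mem_span_basis (hirr : IsUnitaryDual irr) (D : BasisChoices irr S) (x : D.X)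
    {φ : G → ℂ} (hφ : WithLp.toLp 2 φ ∈ Submodule.span ℂ (Set.range (D.basis x))) :
    WithLp.toLp 2 (fun g => conj (φ g)) ∈ Submodule.span ℂ (Set.range (D.basis x)) := by
  set W := Submodule.span ℂ (Set.range (D.basis x)) with hW
  suffices ∀ f ∈ W, WithLp.toLp 2 (fun g => conj (f g)) ∈ W from this _ hφ
  intro f hf
  induction hf using Submodule.span_induction with
  | mem f hf =>
    obtain ⟨b, rfl⟩ := hf
    have hb : D.basis x b ∈ W := Submodule.subset_span (Set.mem_range_self b)
    convert hb using 1
    ext g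
    simp only [basis_apply hirr, Complex.conj_ofReal]
  | zero => convert W.zero_mem using 1; ext g; simp
  | add a b _ _ ha hb => convert W.add_mem ha hb using 1; ext g; simp
  | smul c a _ ha => convert W.smul_mem (conj c) ha using 1; ext g; simp

lemma re_coeff_mem_span_basis (hirr : IsUnitaryDual irr) (D : BasisChoices irr S) (x : D.X)
    (b : D.Index) :
    (WithLp.toLp 2 fun g => (((irr (D.rep b)).coeff (D.left b) (D.right x b) g).re : ℂ)) ∈
      Submodule.span ℂ (Set.range (D.basis x)) := by
  have hs : √(D.scale b) / √(Fintype.card G : ℝ) ≠ 0 := by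
    have := D.scale_pos hirr b
    have hN : (0 : ℝ) < Fintype.card G := by exact_mod_cast Fintype.card_pos
    positivity
  convert Submodule.smul_mem _ (((√(D.scale b) / √(Fintype.card G : ℝ) : ℝ) : ℂ)⁻¹)
    (Submodule.subset_span (R := ℂ) (Set.mem_range_self (f := D.basis x) b)) using 1
  ext g
  rw [PiLp.smul_apply, basis_apply hirr, smul_eq_mul, Complex.ofReal_mul,
    inv_mul_cancel_left₀ (by exact_mod_cast hs)]

omit [Fintype G] in
lemma coeff_mem_of_re_phase {R : UnitaryRep.{u, u} G} {W : Submodule ℂ (EuclideanSpace ℂ G)}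
    {v y : R.V} (h : ∀ s, (WithLp.toLp 2 fun g => ((R.coeff (phase s • v) y g).re : ℂ)) ∈ W) :
    WithLp.toLp 2 (R.coeff v y) ∈ W := by
  convert W.add_mem (h false) (W.smul_mem Complex.I (h true)) using 1
  ext g
  simp only [PiLp.add_apply, PiLp.smul_apply, UnitaryRep.coeff_smul_left, phase_mul_re, smul_eq_mul]
  rw [mul_comm, Complex.re_add_im]

lemma span_isometry_basis {𝕜 E κ : Type*} [RCLike 𝕜] [NormedAddCommGroup E]
    [InnerProductSpace 𝕜 E] [CompleteSpace E] [Fintype κ] (u : IsometryGroup 𝕜 E)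
    (e : OrthonormalBasis κ 𝕜 E) :
    Submodule.span 𝕜 (Set.range fun j => u.1 (e j)) = ⊤ :=
  ((e.map (Unitary.linearIsometryEquiv u)).toBasis.span_eq)

lemma coeff_mem_span_basis_of_mem (hirr : IsUnitaryDual irr) (D : BasisChoices irr S) (x : D.X)
    {i : ι} (hi : i ∈ D.C) (v y : (irr i).V) :
    WithLp.toLp 2 ((irr i).coeff v y) ∈ Submodule.span ℂ (Set.range (D.basis x)) := by
  refine UnitaryRep.coeff_mem_of_left (D.vC ⟨i, hi⟩).toBasis.span_eq ?_ v
  rintro _ ⟨k, rfl⟩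
  refine UnitaryRep.coeff_mem_of_right (span_isometry_basis (x.1 ⟨i, hi⟩) (D.eC ⟨i, hi⟩)) ?_ y
  rintro _ ⟨j, rfl⟩
  rw [OrthonormalBasis.coe_toBasis]
  exact coeff_mem_of_re_phase fun s => D.re_coeff_mem_span_basis hirr x (.inl ⟨⟨i, hi⟩, k, j, s⟩)

lemma coeff_mem_span_basis_of_isQuaternionicType (hirr : IsUnitaryDual irr)
    (D : BasisChoices irr S) (x : D.X) {i : ι} (hi : (irr i).IsQuaternionicType)
    (v y : (irr i).V) :
    WithLp.toLp 2 ((irr i).coeff v y) ∈ Submodule.span ℂ (Set.range (D.basis x)) := by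
  have hl : ∀ k y, WithLp.toLp 2 ((irr i).coeff (D.vQ ⟨i, hi⟩ (.inl k)) y) ∈
      Submodule.span ℂ (Set.range (D.basis x)) := fun k y => by
    refine UnitaryRep.coeff_mem_of_right
      (span_isometry_basis (x.2.1 ⟨i, hi⟩) (D.eQ ⟨i, hi⟩)) ?_ y
    rintro _ ⟨j, rfl⟩
    exact coeff_mem_of_re_phase fun s =>
      D.re_coeff_mem_span_basis hirr x (.inr (.inl ⟨⟨i, hi⟩, k, j, s⟩))
  refine UnitaryRep.coeff_mem_of_left (D.vQ ⟨i, hi⟩).toBasis.span_eq ?_ v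
  rintro _ ⟨k, rfl⟩
  rw [OrthonormalBasis.coe_toBasis]
  rcases k with k | k
  · exact hl k y
  · have hJ := D.JQ_spec ⟨i, hi⟩
    -- `⟨π(g) J v, y⟩` is the conjugate of a coefficient with left vector `v`, as `y = J (-J y)`.
    have hy : y = D.JQ ⟨i, hi⟩ (-D.JQ ⟨i, hi⟩ y) := by rw [map_neg, hJ.2]; simp
    rw [D.vQ_J, hy]
    convert D.conj_mem_span_basis hirr x (hl k (-D.JQ ⟨i, hi⟩ y)) using 3 with g
    exact (hJ.conj_coeff (hirr.irreducible i) (by simp) _ _ g).symm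

lemma coeff_mem_span_basis_of_isRealType (hirr : IsUnitaryDual irr)
    (D : BasisChoices irr S) (x : D.X) {i : ι} (hi : (irr i).IsRealType)
    (v y : (irr i).V) :
    WithLp.toLp 2 ((irr i).coeff v y) ∈ Submodule.span ℂ (Set.range (D.basis x)) := by
  obtain ⟨bv, hbv⟩ := (D.JR_spec ⟨i, hi⟩).exists_orthonormalBasis (hirr.irreducible i)
    (D.vR ⟨i, hi⟩)
  obtain ⟨be, hbe⟩ := (D.JR_spec ⟨i, hi⟩).exists_orthonormalBasis (hirr.irreducible i)
    ((D.eR ⟨i, hi⟩).map (Unitary.linearIsometryEquiv (x.2.2 ⟨i, hi⟩)))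
  refine UnitaryRep.coeff_mem_of_left bv.toBasis.span_eq ?_ v
  rintro _ ⟨k, rfl⟩
  refine UnitaryRep.coeff_mem_of_right be.toBasis.span_eq ?_ y
  rintro _ ⟨j, rfl⟩
  rw [OrthonormalBasis.coe_toBasis, OrthonormalBasis.coe_toBasis, hbv, hbe]
  have h := D.re_coeff_mem_span_basis hirr x (.inr (.inr ⟨⟨i, hi⟩, k, j⟩))
  convert h using 3 with g
  refine (D.JR_spec ⟨i, hi⟩).inner_eq_ofReal_re_of_fixed (hirr.irreducible i)
    ((x.2.2 ⟨i, hi⟩).1 (D.eR ⟨i, hi⟩ j)).2 ?_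
  rw [(D.JR_spec ⟨i, hi⟩).1]
  exact congrArg _ (D.vR ⟨i, hi⟩ k).2

theorem span_basis_eq_top (hirr : IsUnitaryDual irr) (D : BasisChoices irr S) (x : D.X) :
    Submodule.span ℂ (Set.range (D.basis x)) = ⊤ := by
  refine UnitaryRep.span_coeff_eq_top hirr fun i v y => ?_
  by_cases hsd : (irr i).IsSelfDual
  · rcases (hirr.irreducible i).isRealType_or_isQuaternionicType hsd with h | h
    · exact D.coeff_mem_span_basis_of_isRealType hirr x h v y
    · exact D.coeff_mem_span_basis_of_isQuaternionicType hirr x h v y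
  by_cases hi : i ∈ D.C
  · exact D.coeff_mem_span_basis_of_mem hirr x hi v y
  -- Otherwise the dual has been chosen; its coefficients are conjugate to those of `irr i`.
  obtain ⟨j, hj⟩ := hirr.complete _ (hirr.irreducible i).dual
  have hjC : j ∈ D.C := by
    rcases D.pair i j hsd (UnitaryRep.isDualOf_iff.mpr hj.symm) with h | h
    · exact absurd h.1 hi
    · exact h.1
  obtain ⟨T, hT⟩ := hj
  convert D.conj_mem_span_basis hirr x (D.coeff_mem_span_basis_of_mem hirr x hjC
    (T ((irr i).toDual v)) (T ((irr i).toDual y))) using 3 with g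
  rw [UnitaryRep.coeff_map_equiv T hT, UnitaryRep.coeff_dual, Complex.conj_conj]

theorem isRealOrthonormalEigenbasis_basis (hirr : IsUnitaryDual irr) (hS : ∀ s ∈ S, s⁻¹ ∈ S)
    (D : BasisChoices irr S) (x : D.X) : IsRealOrthonormalEigenbasis S (D.basis x) :=
  ⟨D.orthonormal_basis hirr x, D.span_basis_eq_top hirr x, fun b =>
    ⟨fun g => by rw [basis_apply hirr, Complex.ofReal_im],
      D.exists_cayleyAdjacency_basis_eq hirr hS x b⟩⟩
end BasisChoices

/-! ### Concentration for the random basis -/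

namespace UnitaryRep
section
variable {G : Type v} [Group G] [Fintype G]

/-- The unit vectors `π(g) x` form a tight frame of the real inner product space underlying `V`,
of dimension `2 dim V`; the row sums of their squared Gram matrix are instances of `hrow`. -/
lemma haarProb_re_coeff_deviation {R : UnitaryRep.{v, w} G} {x e : R.V} (hx : ‖x‖ = 1)
    (he : ‖e‖ = 1) (hrow : ∀ y, ‖y‖ = 1 →
      ∑ g, (R.coeff x y g).re * (R.coeff x y g).re = Fintype.card G / (2 * R.dim))
    (f : EuclideanSpace ℝ G) {t : ℝ} (ht : 0 < t) :
    (haarProb ℂ R.V).real {u | t * (‖f‖ / √(Fintype.card G)) <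
        |∑ g, (√(2 * R.dim) / √(Fintype.card G) * (R.coeff x (u.1 e) g).re) ^ 2 * f g -
          (∑ g, f g) / Fintype.card G|} ≤
      2 * (Real.exp (1 / 8) * Real.exp (-(t * √(2 * R.dim) / 8))) := by
  have : Nontrivial R.V := ⟨x, 0, norm_ne_zero_iff.mp (hx ▸ one_ne_zero)⟩
  have : FiniteDimensional ℝ R.V := FiniteDimensional.complexToReal R.V
  have hfin : (Module.finrank ℝ R.V : ℝ) = 2 * R.dim := by
    exact_mod_cast finrank_real_of_complex R.V
  have hinner : ∀ (g : G) (y : R.V), inner ℝ (R.π g x) y = (R.coeff x y g).re := fun g y => by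
    rw [real_inner_comm]; rfl
  have h := haarProb_weighted_frame_deviation (𝕜 := ℂ) (fun g => R.π g x)
    (fun g => by rw [LinearIsometryEquiv.norm_map, hx]) (fun g => by
      rw [hfin, ← hrow (R.π g x) (by rw [LinearIsometryEquiv.norm_map, hx])]
      refine le_of_eq (Finset.sum_congr rfl fun h _ => ?_)
      rw [real_inner_comm, hinner, sq]) f ht he
  rw [hfin] at h
  refine le_trans (le_of_eq ?_) h
  congr 1
  ext u
  simp only [Set.mem_ofPred_eq, hinner, mul_pow, div_pow]
  rw [Real.sq_sqrt (by positivity), Real.sq_sqrt (by positivity)]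

/-- The analogue in the real form, where the orbit of `x` stays in `V_J` because `J` commutes
with `π`. -/
lemma haarProb_realForm_coeff_deviation {R : UnitaryRep.{v, w} G} {J : R.V →ₛₗ[starRingEnd ℂ] R.V}
    (hJ : R.IsStructureMap 1 J) (hdim : Module.finrank ℝ (R.realForm J) = R.dim)
    {x e : R.realForm J} (hx : ‖x‖ = 1) (he : ‖e‖ = 1)
    (hrow : ∀ y : R.realForm J, ‖y‖ = 1 →
      ∑ g, (R.coeff (x : R.V) (y : R.V) g).re * (R.coeff (x : R.V) (y : R.V) g).re =
        Fintype.card G / R.dim)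
    (f : EuclideanSpace ℝ G) {t : ℝ} (ht : 0 < t) :
    (haarProb ℝ (R.realForm J)).real {u | t * (‖f‖ / √(Fintype.card G)) <
        |∑ g, (√R.dim / √(Fintype.card G) *
          (R.coeff (x : R.V) ((u.1 e : R.realForm J) : R.V) g).re) ^ 2 * f g -
          (∑ g, f g) / Fintype.card G|} ≤
      2 * (Real.exp (1 / 8) * Real.exp (-(t * √R.dim / 8))) := by
  have : Nontrivial (R.realForm J) := ⟨x, 0, norm_ne_zero_iff.mp (hx ▸ one_ne_zero)⟩
  let z : G → R.realForm J := fun g => ⟨R.π g x, by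
    change J (R.π g x) = R.π g x
    rw [hJ.1]
    exact congrArg _ x.2⟩
  have hz : ∀ g, ‖z g‖ = 1 := fun g => ((R.π g).norm_map x).trans hx
  have hinner : ∀ (g : G) (y : R.realForm J), inner ℝ (z g) y = (R.coeff (x : R.V) y g).re :=
    fun g y => by
      rw [real_inner_comm]; rfl
  have h := haarProb_weighted_frame_deviation (𝕜 := ℝ) z hz (fun g => by
      rw [hdim, ← hrow (z g) (hz g)]
      refine le_of_eq (Finset.sum_congr rfl fun h _ => ?_)
      rw [real_inner_comm, hinner, sq]) f ht he
  rw [hdim] at h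
  refine le_trans (le_of_eq ?_) h
  congr 1
  ext u
  simp only [Set.mem_ofPred_eq, hinner, mul_pow, div_pow]
  rw [Real.sq_sqrt (by positivity), Real.sq_sqrt (by positivity)]

end
end UnitaryRep

/-- The Chernoff bound obtained here is stronger than the target: the second exponential is not
needed. -/
lemma two_mul_exp_le_tail {t : ℝ} (ht : 0 < t) {d n : ℝ} (hdn : d ≤ n) :
    2 * (Real.exp (1 / 8) * Real.exp (-(t * √n / 8))) ≤
      6 * Real.exp (-(t * √d / 64)) + 2 * Real.exp (-d / 12) := by
  have h1 : Real.exp (1 / 8) ≤ 3 :=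
    (Real.exp_le_exp.mpr (by norm_num)).trans Real.exp_one_lt_three.le
  have h2 : Real.exp (-(t * √n / 8)) ≤ Real.exp (-(t * √d / 64)) := by
    refine Real.exp_le_exp.mpr ?_
    have h3 : t * √d ≤ t * √n := by gcongr
    have h4 : 0 ≤ t * √d := by positivity
    linarith
  have h3 := mul_le_mul h1 h2 (Real.exp_pos _).le (by norm_num)
  linarith [Real.exp_pos (-d / 12)]

/-- For an arbitrary set only the inequality `≤` holds in general; it needs no measurability. -/
lemma MeasureTheory.MeasurePreserving.measureReal_preimage_le {α β : Type*}
    [MeasurableSpace α] [MeasurableSpace β] {μ : Measure α} {ν : Measure β}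
    [IsFiniteMeasure ν] {p : α → β}
    (hp : MeasurePreserving p μ ν) (A : Set β) : μ.real (p ⁻¹' A) ≤ ν.real A := by
  have h := Measure.le_map_apply (μ := μ) hp.measurable.aemeasurable A
  rw [hp.map_eq] at h
  exact ENNReal.toReal_mono (measure_ne_top ν A) h

namespace BasisChoices
variable {G : Type u} [Group G] {ι : Type w} {irr : ι → UnitaryRep.{u, u} G} {S : Finset G}

section prob
variable [Fintype ι]

open scoped Classical in
instance isProbabilityMeasure_P (D : BasisChoices irr S) : IsProbabilityMeasure D.P := by
  unfold P; infer_instance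

section product
variable {α β γ : Type*} [Fintype α] [Fintype β] [Fintype γ] {A : α → Type*} {B : β → Type*}
  {C : γ → Type*} [∀ i, MeasurableSpace (A i)] [∀ i, MeasurableSpace (B i)]
  [∀ i, MeasurableSpace (C i)] (μ : ∀ i, Measure (A i)) (ν : ∀ i, Measure (B i))
  (ρ : ∀ i, Measure (C i)) [∀ i, IsProbabilityMeasure (μ i)] [∀ i, IsProbabilityMeasure (ν i)]
  [∀ i, IsProbabilityMeasure (ρ i)]

lemma measurePreserving_pi_prod_fst (i : α) : MeasurePreserving (fun x => x.1 i)
    ((Measure.pi μ).prod ((Measure.pi ν).prod (Measure.pi ρ))) (μ i) :=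
  (measurePreserving_eval μ i).comp measurePreserving_fst

lemma measurePreserving_pi_prod_snd_fst (i : β) : MeasurePreserving (fun x => x.2.1 i)
    ((Measure.pi μ).prod ((Measure.pi ν).prod (Measure.pi ρ))) (ν i) :=
  (measurePreserving_eval ν i).comp (measurePreserving_fst.comp measurePreserving_snd)

lemma measurePreserving_pi_prod_snd_snd (i : γ) : MeasurePreserving (fun x => x.2.2 i)
    ((Measure.pi μ).prod ((Measure.pi ν).prod (Measure.pi ρ))) (ρ i) :=
  (measurePreserving_eval ρ i).comp (measurePreserving_snd.comp measurePreserving_snd)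

end product

open scoped Classical in
lemma measurePreserving_nonSelfDual (D : BasisChoices irr S) (i : D.C) :
    MeasurePreserving (fun x : D.X => x.1 i) D.P (haarProb ℂ (irr i).V) :=
  measurePreserving_pi_prod_fst _ _ _ i

open scoped Classical in
lemma measurePreserving_quaternionic (D : BasisChoices irr S)
    (i : {i // (irr i).IsQuaternionicType}) :
    MeasurePreserving (fun x : D.X => x.2.1 i) D.P (haarProb ℂ (irr i).V) :=
  measurePreserving_pi_prod_snd_fst _ _ _ i

open scoped Classical in
lemma measurePreserving_real (D : BasisChoices irr S) (i : {i // (irr i).IsRealType}) :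
    MeasurePreserving (fun x : D.X => x.2.2 i) D.P
      (haarProb ℝ ((irr i).realForm (D.JR i))) :=
  measurePreserving_pi_prod_snd_snd _ _ _ i
end prob

variable [Fintype G]

lemma quantumMean_basis (hirr : IsUnitaryDual irr) (D : BasisChoices irr S) (x : D.X)
    (b : D.Index) (f : EuclideanSpace ℝ G) : quantumMean (D.basis x b) f =
      ∑ g, (√(D.scale b) / √(Fintype.card G) *
        ((irr (D.rep b)).coeff (D.left b) (D.right x b) g).re) ^ 2 * f g := by
  simp only [quantumMean, basis_apply hirr, Complex.norm_real, Real.norm_eq_abs, sq_abs]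

/-- The event that the quantum mean of `f` in the basis function `b` is too far from the average
of `f`. -/
def deviationEvent (D : BasisChoices irr S) (f : EuclideanSpace ℝ G) (t : ℝ) (b : D.Index) :
    Set D.X :=
  {x | t * (‖f‖ / √(Fintype.card G)) <
    |quantumMean (D.basis x b) f - (∑ g, f g) / Fintype.card G|}

/-- For the trivial representation the basis function is constant, hence has uniform `|φ|²`. -/
lemma deviationEvent_eq_empty (hirr : IsUnitaryDual irr) (D : BasisChoices irr S)
    (f : EuclideanSpace ℝ G) {t : ℝ} (ht : 0 < t) {b : D.Index}
    (hb : (irr (D.rep b)).Equivalent (UnitaryRep.triv G)) : D.deviationEvent f t b = ∅ := by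
  classical
  obtain ⟨T, hT⟩ := hb
  have hπ : ∀ g y, (irr (D.rep b)).π g y = y := fun g y => T.injective (hT g y)
  have hN : (Fintype.card G : ℝ) ≠ 0 := by exact_mod_cast Fintype.card_ne_zero
  ext x
  simp only [deviationEvent, Set.mem_ofPred_eq, Set.mem_empty_iff_false, iff_false, not_lt]
  set r := √(D.scale b) / √(Fintype.card G) * (inner ℂ (D.right x b) (D.left b) : ℂ).re with hr
  have hconst : ∀ g, √(D.scale b) / √(Fintype.card G) *
      ((irr (D.rep b)).coeff (D.left b) (D.right x b) g).re = r := fun g => by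
    rw [UnitaryRep.coeff, hπ]
  have h1 := D.sum_basis_mul_basis hirr x b b
  rw [if_pos rfl] at h1
  simp_rw [hconst] at h1
  have h2 : r ^ 2 = 1 / Fintype.card G := by
    rw [Finset.sum_const, Finset.card_univ, nsmul_eq_mul] at h1
    field_simp
    linarith
  rw [quantumMean_basis hirr]
  simp_rw [hconst, h2]
  rw [← Finset.mul_sum, one_div_mul_eq_div, sub_self, abs_zero]
  positivity

theorem measureReal_deviationEvent_le [Fintype ι] (hirr : IsUnitaryDual irr)
    (D : BasisChoices irr S) (f : EuclideanSpace ℝ G) {t : ℝ} (ht : 0 < t) (b : D.Index) :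
    D.P.real (D.deviationEvent f t b) ≤ 6 * Real.exp (-(t * √(irr (D.rep b)).dim / 64)) +
      2 * Real.exp (-((irr (D.rep b)).dim : ℝ) / 12) := by
  have hset : D.deviationEvent f t b = {x | t * (‖f‖ / √(Fintype.card G)) <
      |∑ g, (√(D.scale b) / √(Fintype.card G) *
        ((irr (D.rep b)).coeff (D.left b) (D.right x b) g).re) ^ 2 * f g -
        (∑ g, f g) / Fintype.card G|} := by
    ext x
    rw [deviationEvent, Set.mem_ofPred_eq, Set.mem_ofPred_eq, quantumMean_basis hirr]
  rw [hset]
  rcases b with ⟨i, k, j, s⟩ | ⟨i, k, j, s⟩ | ⟨i, k, j⟩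
  · have h := UnitaryRep.haarProb_re_coeff_deviation (x := phase s • D.vC i k) (e := D.eC i j)
      (by rw [norm_smul, norm_phase, (D.vC i).norm_eq_one, one_mul]) ((D.eC i).norm_eq_one j)
      (fun y hy => by
        rw [D.sum_re_coeff_nonSelfDual hirr, if_pos rfl, mul_one,
          inner_self_eq_one_of_norm_eq_one hy, mul_one, re_conj_phase_mul, if_pos rfl, mul_one]) f ht
    refine ((D.measurePreserving_nonSelfDual i).measureReal_preimage_le _).trans (h.trans ?_)
    exact two_mul_exp_le_tail (d := (irr i).dim) ht (by linarith [dim_pos hirr i.1])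
  · have h := UnitaryRep.haarProb_re_coeff_deviation (x := phase s • D.vQ i (.inl k))
      (e := D.eQ i j)
      (by rw [norm_smul, norm_phase, (D.vQ i).norm_eq_one, one_mul]) ((D.eQ i).norm_eq_one j)
      (fun y hy => by
        rw [D.sum_re_coeff_quaternionic hirr, if_pos rfl, mul_one,
          inner_self_eq_one_of_norm_eq_one hy, mul_one, re_conj_phase_mul, if_pos rfl, mul_one]) f ht
    refine ((D.measurePreserving_quaternionic i).measureReal_preimage_le _).trans (h.trans ?_)
    exact two_mul_exp_le_tail (d := (irr i).dim) ht (by linarith [dim_pos hirr i.1])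
  · have h := UnitaryRep.haarProb_realForm_coeff_deviation (D.JR_spec i)
      (by simpa using Module.finrank_eq_card_basis (D.vR i).toBasis)
      (x := D.vR i k) (e := D.eR i j) ((D.vR i).norm_eq_one k) ((D.eR i).norm_eq_one j)
      (fun y hy => by
        have hy' : ‖(y : (irr i).V)‖ = 1 := hy
        rw [D.sum_re_coeff_real hirr, if_pos rfl, inner_self_eq_one_of_norm_eq_one hy']
        simp) f ht
    refine ((D.measurePreserving_real i).measureReal_preimage_le _).trans (h.trans ?_)
    exact two_mul_exp_le_tail ht le_rfl

open scoped Classical in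
omit [Fintype G] in
/-- There are `2 d²` basis functions for a chosen non-self-dual representation of dimension `d`,
and at most `d²` for a self-dual one of either type. -/
lemma sum_index_le [Fintype ι] (D : BasisChoices irr S) (F : ι → ℝ) (hF : ∀ i, 0 ≤ F i) :
    ∑ b : D.Index, F (D.rep b) ≤ 2 * ∑ i, ((irr i).dim : ℝ) ^ 2 * F i := by
  have hsub : ∀ (p : ι → Prop) (H : ι → ℝ), ∑ i : {i // p i}, H i = ∑ i, if p i then H i else 0 :=
    fun p H => by rw [← Finset.sum_filter, ← Finset.sum_subtype_eq_sum_filter]; simp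
  rw [Fintype.sum_sum_type, Fintype.sum_sum_type, Fintype.sum_sigma, Fintype.sum_sigma,
    Fintype.sum_sigma]
  simp only [rep, Finset.sum_const, Finset.card_univ, Fintype.card_prod, Fintype.card_fin,
    Fintype.card_bool, nsmul_eq_mul, Nat.cast_mul]
  have h1 := hsub (· ∈ D.C) fun i => ((irr i).dim : ℝ) * ((irr i).dim * (2 : ℕ)) * F i
  have h2 := hsub (fun i => (irr i).IsQuaternionicType) fun i =>
    (((irr i).dim / 2 : ℕ) : ℝ) * ((irr i).dim * (2 : ℕ)) * F i
  have h3 := hsub (fun i => (irr i).IsRealType) fun i =>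
    ((irr i).dim : ℝ) * ((irr i).dim : ℝ) * F i
  rw [h2, h3]
  refine (congrArg (· + _) h1).trans_le ?_
  rw [← Finset.sum_add_distrib, ← Finset.sum_add_distrib, Finset.mul_sum]
  refine Finset.sum_le_sum fun i _ => ?_
  have hd : (((irr i).dim / 2 : ℕ) : ℝ) * 2 ≤ (irr i).dim := by
    exact_mod_cast Nat.div_mul_le_self _ _
  have hd0 : (0 : ℝ) ≤ (irr i).dim := by positivity
  have hFd : 0 ≤ ((irr i).dim : ℝ) * F i := mul_nonneg hd0 (hF i)
  have hdF := mul_le_mul_of_nonneg_right hd hFd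
  have hq : 0 ≤ ((irr i).dim : ℝ) * (((irr i).dim : ℝ) * F i) := mul_nonneg hd0 hFd
  by_cases hC : i ∈ D.C
  · have hQ : ¬ (irr i).IsQuaternionicType := fun h => D.not_selfDual i hC h.1
    have hR : ¬ (irr i).IsRealType := fun h => D.not_selfDual i hC h.1
    rw [if_pos hC, if_neg hQ, if_neg hR]
    push_cast
    linarith
  · rw [if_neg hC]
    split_ifs <;> push_cast <;> linarith

end BasisChoices

open scoped Classical in
theorem theorem1p4 {G : Type u} [Group G] [Fintype G]
    (S : Finset G) (hS : ∀ s ∈ S, s⁻¹ ∈ S)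
    {ι : Type w} [Fintype ι] (irr : ι → UnitaryRep.{u, u} G) (hirr : IsUnitaryDual irr)
    (D : BasisChoices irr S)
    (M : ℕ) (f : Fin M → EuclideanSpace ℝ G) (t : ℝ) (ht : 0 < t) :
    IsProbabilityMeasure D.P ∧
    (∀ x : D.X, IsRealOrthonormalEigenbasis S (D.basis x)) ∧
    1 - 2 * (M : ℝ) * ∑ i with ¬ (irr i).Equivalent (UnitaryRep.triv G),
        ((irr i).dim : ℝ) ^ 2 *
          (6 * Real.exp (-(t * √(irr i).dim / 64)) + 2 * Real.exp (-((irr i).dim : ℝ) / 12)) ≤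
      D.P.real {x : D.X | ∀ (b : D.Index) (m : Fin M),
        |quantumMean (D.basis x b) (f m) - (∑ g, f m g) / Fintype.card G| ≤
          t * (‖f m‖ / √(Fintype.card G))} := by
  refine ⟨inferInstance, fun x => D.isRealOrthonormalEigenbasis_basis hirr hS x, ?_⟩
  set good : Set D.X := {x : D.X | ∀ (b : D.Index) (m : Fin M),
        |quantumMean (D.basis x b) (f m) - (∑ g, f m g) / Fintype.card G| ≤
          t * (‖f m‖ / √(Fintype.card G))} with hgood
  set B : ι → ℝ := fun i =>
    6 * Real.exp (-(t * √(irr i).dim / 64)) + 2 * Real.exp (-((irr i).dim : ℝ) / 12) with hB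
  set F : ι → ℝ := fun i => if ¬ (irr i).Equivalent (UnitaryRep.triv G) then B i else 0 with hF
  have hF0 : ∀ i, 0 ≤ F i := fun i => by
    simp only [hF, hB]; split_ifs <;> positivity
  have hbad : ∀ b m, D.P.real (D.deviationEvent (f m) t b) ≤ F (D.rep b) := fun b m => by
    by_cases h : (irr (D.rep b)).Equivalent (UnitaryRep.triv G)
    · rw [D.deviationEvent_eq_empty hirr _ ht h, measureReal_empty]
      exact hF0 _
    · simp only [hF, if_pos h]
      exact D.measureReal_deviationEvent_le hirr (f m) ht b
  have hcover : (Set.univ : Set D.X) ⊆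
      good ∪ ⋃ p : D.Index × Fin M, D.deviationEvent (f p.2) t p.1 := fun x _ => by
    by_cases hx : x ∈ good
    · exact .inl hx
    · simp only [hgood, Set.mem_ofPred_eq, not_forall, not_le] at hx
      obtain ⟨b, m, hbm⟩ := hx
      exact .inr (Set.mem_iUnion.mpr ⟨(b, m), hbm⟩)
  have h1 : (1 : ℝ) ≤ D.P.real good + ∑ p : D.Index × Fin M,
      D.P.real (D.deviationEvent (f p.2) t p.1) := by
    calc (1 : ℝ) = D.P.real Set.univ := by simp
      _ ≤ _ := measureReal_mono hcover
      _ ≤ _ := measureReal_union_le _ _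
      _ ≤ _ := by gcongr; exact measureReal_iUnion_fintype_le _
  have h2 : ∑ p : D.Index × Fin M, D.P.real (D.deviationEvent (f p.2) t p.1) ≤
      2 * M * ∑ i, ((irr i).dim : ℝ) ^ 2 * F i := by
    calc ∑ p : D.Index × Fin M, D.P.real (D.deviationEvent (f p.2) t p.1)
        ≤ ∑ p : D.Index × Fin M, F (D.rep p.1) := Finset.sum_le_sum fun p _ => hbad _ _
      _ = M * ∑ b : D.Index, F (D.rep b) := by
          rw [Fintype.sum_prod_type, Finset.mul_sum]; simp
      _ ≤ M * (2 * ∑ i, ((irr i).dim : ℝ) ^ 2 * F i) := by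
          gcongr; exact D.sum_index_le F hF0
      _ = _ := by ring
  have h3 : ∑ i, ((irr i).dim : ℝ) ^ 2 * F i =
      ∑ i with ¬ (irr i).Equivalent (UnitaryRep.triv G), ((irr i).dim : ℝ) ^ 2 * B i := by
    rw [Finset.sum_filter]
    refine Finset.sum_congr rfl fun i _ => ?_
    simp only [hF, mul_ite, mul_zero]
  rw [h3] at h2
  linarith
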